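/- Products of maps are read from left to right ($fg$ means: first $f$, then $g$), and $[a,b]=aba^{-1}b^{-1}$. Let $F$ be Thompson's group of orientation-preserving piecewise-linear homeomorphisms of $[0,1]$ with finitely many breakpoints, all dyadic, and all slopes powers of $2$. Let $PL_2^+(\mathbb R)$ be the group of orientation-preserving piecewise-linear homeomorphisms of $\mathbb R$ which map $\mathbb Z[\frac12]$ onto itself, with a discrete set of dyadic breakpoints and with slopes powers of $2$, and let ${\rm Aut}^+F$ be the subgroup of those $\alpha\in PL_2^+(\mathbb R)$ with $\alpha(x+1)=\alpha(x)+1$ for all $x$ outside some bounded interval. Near $+\infty$ and near $-\infty$ such an $\alpha$ induces homeomorphisms of the circle $\mathbb R/\mathbb Z$, which gives the homomorphism $\pi:{\rm Aut}^+F\to T\times T$, where $T\supset F$ is Thompson's group of the circle. Let $C=\pi^{-1}(\{(g,g)\mid g\in F\})$. Let $F_x\le PL_2^+(\mathbb R)$ be the copy of $F$ that consists of the elements which are translations by integers near $+\infty$ and near $-\infty$ (the two integers may differ), and let $F_w$ be the copy of $F$ that consists of the periodic extensions $\hat g$ of the elements $g\in F$, $\hat g(k+t)=k+g(t)$ for $k\in\mathbb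 Z$, $t\in[0,1]$. Let $x_0,x_1\in F_x$ be given by $x_0(t)=t+1$, and $x_1(t)=t$ for $t\le 0$, $x_1(t)=2t$ for $0\le t\le 1$, $x_1(t)=t+1$ for $t\ge 1$. Let $w_0=\hat g_0$ and $w_1=\hat g_1$ where $g_0,g_1$ are the standard generators of $F$: $g_0(t)=2t$ on $[0,\frac14]$, $t+\frac14$ on $[\frac14,\frac12]$, $\frac{t+1}2$ on $[\frac12,1]$; and $g_1(t)=t$ on $[0,\frac12]$, $2t-\frac12$ on $[\frac12,\frac58]$, $t+\frac18$ on $[\frac58,\frac34]$, $\frac{t+1}2$ on $[\frac34,1]$. Then $F_x$ and $F_w$ are subgroups of $C$, $F_x$ is normal in $C$, and $C$ is the internal semidirect product $F_x\rtimes F_w$. Moreover, $C$ is presented, on the elements $x_0,x_1,w_0,w_1$, by $$\begin{aligned} \langle x_0,x_1,w_0,w_1\mid\ &[x_0x_1^{-1},x_0^{-1}x_1x_0],\ [x_0x_1^{-1},x_0^{-2}x_1x_0^2],\\ &[w_0w_1^{-1},w_0^{-1}w_1w_0],\ [w_0w_1^{-1},w_0^{-2}w_1w_0^2],\\ &[x_0,w_0],\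 [x_0,w_1],\\ &w_0x_1w_0^{-1}=x_1^3x_0^{-1}x_1x_0^{-3}x_1x_0x_1^{-2}x_0^3x_1^{-2},\\ &w_1x_1w_1^{-1}=x_1^2x_0^{-1}x_1x_0^{-1}x_1x_0^{-2}x_1^2x_0^{-2}x_1x_0x_1^{-2}x_0x_1^{-1}x_0^3x_1^{-2}x_0x_1^{-1}\rangle. \end{aligned}$$ -/

import Mathlib

open Set Filter

namespace ThompsonAut

noncomputable section

/-- Dyadic rationals, as real numbers. -/
def IsDyadic (x : ℝ) : Prop := ∃ (m : ℤ) (n : ℕ), x = m / 2 ^ n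

theorem IsDyadic.add {x y : ℝ} (hx : IsDyadic x) (hy : IsDyadic y) : IsDyadic (x + y) := by
  obtain ⟨m, n, rfl⟩ := hx
  obtain ⟨k, l, rfl⟩ := hy
  refine ⟨m * 2 ^ l + k * 2 ^ n, n + l, ?_⟩
  push_cast
  field_simp
  ring

theorem IsDyadic.neg {x : ℝ} (hx : IsDyadic x) : IsDyadic (-x) := by
  obtain ⟨m, n, rfl⟩ := hx
  exact ⟨-m, n, by push_cast; ring⟩

theorem IsDyadic.sub {x y : ℝ} (hx : IsDyadic x) (hy : IsDyadic y) : IsDyadic (x - y) := by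
  rw [sub_eq_add_neg]
  exact hx.add hy.neg

theorem IsDyadic.zpow_mul {x : ℝ} (hx : IsDyadic x) (k : ℤ) : IsDyadic ((2 : ℝ) ^ k * x) := by
  obtain ⟨m, n, rfl⟩ := hx
  obtain ⟨j, rfl | rfl⟩ := k.eq_nat_or_neg
  · exact ⟨2 ^ j * m, n, by push_cast; rw [zpow_natCast]; ring⟩
  · refine ⟨m, n + j, ?_⟩
    rw [zpow_neg, zpow_natCast, pow_add]
    field_simp

/-- Let `ι : α → ℝ` be the inclusion of an interval `α` of the real line. The increasing
homeomorphism `f` of `α` is piecewise linear with a discrete set of breakpoints (finitely many in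
every compact interval), its breakpoints are dyadic and its slopes are powers of `2`: there is
such a set `B` of points so that `f` is affine, with a power of `2` as its slope, on every interval
without points of `B` in its interior. -/
def IsDyadicPL {α : Type} [LinearOrder α] (ι : α → ℝ) (f : α ≃o α) : Prop :=
  ∃ B : Set α, (∀ b ∈ B, IsDyadic (ι b)) ∧ (∀ a b : α, (B ∩ Icc a b).Finite) ∧
    ∀ a b : α, a < b → Disjoint B (Ioo a b) →
      ∃ (n : ℤ) (c : ℝ), ∀ y ∈ Icc a b, ι (f y) = (2 : ℝ) ^ n * ι y + c

/-- The homeomorphism `f` maps the set of dyadic points onto itself. -/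
def PreservesDyadic {α : Type} [LinearOrder α] (ι : α → ℝ) (f : α ≃o α) : Prop :=
  ∀ x : α, IsDyadic (ι (f x)) ↔ IsDyadic (ι x)

section closure
variable {α : Type} [LinearOrder α] {ι : α → ℝ}

theorem IsDyadicPL.one : IsDyadicPL ι (1 : α ≃o α) :=
  ⟨∅, by simp, by simp, fun _ _ _ _ => ⟨0, 0, fun y _ => by simp⟩⟩

theorem IsDyadicPL.mul {f g : α ≃o α} (hf : IsDyadicPL ι f) (hg : IsDyadicPL ι g)
    (hd : PreservesDyadic ι g) : IsDyadicPL ι (f * g) := by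
  obtain ⟨A, hA, hA', hA''⟩ := hf
  obtain ⟨B, hB, hB', hB''⟩ := hg
  refine ⟨B ∪ g ⁻¹' A, ?_, ?_, ?_⟩
  · rintro b (hb | hb)
    · exact hB b hb
    · exact (hd b).1 (hA _ hb)
  · intro a b
    rw [union_inter_distrib_right]
    refine (hB' a b).union ?_
    refine ((hA' (g a) (g b)).preimage (f := g) g.injective.injOn).subset ?_
    rintro x ⟨hx, hx1, hx2⟩
    exact ⟨hx, g.monotone hx1, g.monotone hx2⟩
  · intro a b hab hdis
    rw [disjoint_union_left] at hdis
    obtain ⟨n, c, h1⟩ := hB'' a b hab hdis.1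
    have hdis' : Disjoint A (Ioo (g a) (g b)) := by
      rw [Set.disjoint_left]
      rintro t ht ⟨ht1, ht2⟩
      have ht' : g.symm t ∈ g ⁻¹' A := by simpa using ht
      refine Set.disjoint_left.1 hdis.2 ht' ⟨?_, ?_⟩
      · exact (g.lt_symm_apply).2 ht1
      · exact (g.symm_apply_lt).2 ht2
    obtain ⟨m, d, h2⟩ := hA'' (g a) (g b) (g.strictMono hab) hdis'
    refine ⟨m + n, 2 ^ m * c + d, fun y hy => ?_⟩
    rw [RelIso.mul_apply, h2 _ ⟨g.monotone hy.1, g.monotone hy.2⟩, h1 y hy,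
      zpow_add₀ (by norm_num : (2 : ℝ) ≠ 0)]
    ring

theorem IsDyadicPL.inv {f : α ≃o α} (hf : IsDyadicPL ι f)
    (hd : PreservesDyadic ι f) : IsDyadicPL ι f⁻¹ := by
  obtain ⟨A, hA, hA', hA''⟩ := hf
  have hs : ∀ y, f (f⁻¹ y) = y := fun y => f.apply_symm_apply y
  have hs' : ∀ y, f⁻¹ (f y) = y := fun y => f.symm_apply_apply y
  have hm : StrictMono (f⁻¹ : α ≃o α) := OrderIso.strictMono _
  refine ⟨(f⁻¹ : α ≃o α) ⁻¹' A, ?_, ?_, ?_⟩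
  · intro b hb
    have := (hd (f⁻¹ b)).2 (hA _ hb)
    rwa [hs] at this
  · intro a b
    refine ((hA' (f⁻¹ a) (f⁻¹ b)).preimage (f := (f⁻¹ : α ≃o α)) hm.injective.injOn).subset ?_
    rintro x ⟨hx, hx1, hx2⟩
    exact ⟨hx, hm.monotone hx1, hm.monotone hx2⟩
  · intro a b hab hdis
    have hdis' : Disjoint A (Ioo (f⁻¹ a) (f⁻¹ b)) := by
      rw [Set.disjoint_left]
      rintro t ht ⟨ht1, ht2⟩
      have ht' : f t ∈ (f⁻¹ : α ≃o α) ⁻¹' A := by simpa [hs'] using ht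
      refine Set.disjoint_left.1 hdis ht' ⟨?_, ?_⟩
      · simpa [hs] using f.strictMono ht1
      · simpa [hs] using f.strictMono ht2
    obtain ⟨n, c, h⟩ := hA'' _ _ (hm hab) hdis'
    refine ⟨-n, -(2 ^ (-n) * c), fun y hy => ?_⟩
    have h1 := h (f⁻¹ y) ⟨hm.monotone hy.1, hm.monotone hy.2⟩
    rw [hs] at h1
    rw [h1, zpow_neg]
    field_simp
    ring

theorem PreservesDyadic.one : PreservesDyadic ι (1 : α ≃o α) := fun _ => Iff.rfl

theorem PreservesDyadic.mul {f g : α ≃o α} (hf : PreservesDyadic ι f) (hg : PreservesDyadic ι g) :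
    PreservesDyadic ι (f * g) := fun x => (hf (g x)).trans (hg x)

theorem PreservesDyadic.inv {f : α ≃o α} (hf : PreservesDyadic ι f) :
    PreservesDyadic ι f⁻¹ := by
  intro x
  have h := hf (f⁻¹ x)
  rw [show f (f⁻¹ x) = x from f.apply_symm_apply x] at h
  exact h.symm

end closure

/-- The unit interval. -/
abbrev I : Type := Icc (0 : ℝ) 1

/-- A dyadic piecewise linear homeomorphism of the unit interval preserves dyadic points. -/
theorem IsDyadicPL.preservesDyadic {f : I ≃o I} (hf : IsDyadicPL (Subtype.val : I → ℝ) f) :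
    PreservesDyadic (Subtype.val : I → ℝ) f := by
  classical
  obtain ⟨A, hA, hA', hA''⟩ := hf
  have hfin : A.Finite := by
    have h := hA' ⊥ ⊤
    rwa [Icc_bot_top, inter_univ] at h
  have h0 : f ⊥ = ⊥ := f.map_bot
  have hz : IsDyadic 0 := ⟨0, 0, by simp⟩
  have key : ∀ (k : ℕ) (x : I), (A ∩ Iio x).ncard = k →
      (IsDyadic (f x : ℝ) ↔ IsDyadic (x : ℝ)) := by
    intro k
    induction k using Nat.strong_induction_on with
    | _ k ih =>
      intro x hk
      have step : ∀ a : I, a < x → Disjoint A (Ioo a x) → IsDyadic (a : ℝ) →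
          IsDyadic (f a : ℝ) → (IsDyadic (f x : ℝ) ↔ IsDyadic (x : ℝ)) := by
        intro a hax hdis ha hfa
        obtain ⟨n, c, h⟩ := hA'' a x hax hdis
        have h1 := h a ⟨le_rfl, hax.le⟩
        have h2 := h x ⟨hax.le, le_rfl⟩
        have h3 : (f x : ℝ) = 2 ^ n * ((x : ℝ) - a) + f a := by rw [h1, h2]; ring
        have h4 : (x : ℝ) = 2 ^ (-n) * ((f x : ℝ) - f a) + a := by
          rw [h3, zpow_neg]
          field_simp
          ring
        constructor
        · intro hx
          rw [h4]
          exact ((hx.sub hfa).zpow_mul _).add ha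
        · intro hx
          rw [h3]
          exact ((hx.sub ha).zpow_mul _).add hfa
      rcases (A ∩ Iio x).eq_empty_or_nonempty with he | hne
      · rcases (bot_le : (⊥ : I) ≤ x).eq_or_lt with hx | hx
        · rw [← hx, h0]
        · refine step ⊥ hx ?_ hz (by rw [h0]; exact hz)
          rw [Set.disjoint_left]
          rintro t ht ⟨_, ht2⟩
          exact (he ▸ (⟨ht, ht2⟩ : t ∈ A ∩ Iio x) : t ∈ (∅ : Set I))
      · have hfx : (A ∩ Iio x).Finite := hfin.subset inter_subset_left
        obtain ⟨a, ⟨haA, hax⟩, hmax⟩ := hfx.exists_maximal hne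
        have had := hA a haA
        have hlt : (A ∩ Iio a).ncard < k := by
          rw [← hk]
          refine ncard_lt_ncard ⟨?_, fun h => ?_⟩ hfx
          · rintro t ⟨h1, h2⟩
            exact ⟨h1, lt_trans (mem_Iio.1 h2) (mem_Iio.1 hax)⟩
          · exact lt_irrefl _ (mem_Iio.1 (h ⟨haA, hax⟩).2)
        refine step a hax ?_ had ((ih _ hlt a rfl).2 had)
        rw [Set.disjoint_left]
        rintro t ht ⟨ht1, ht2⟩
        exact absurd (hmax ⟨ht, ht2⟩ ht1.le) (not_le.2 ht1)
  exact fun x => key _ x rfl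

/-- Thompson's group `F`, as a group of homeomorphisms of the unit interval. -/
def F : Subgroup (I ≃o I) where
  carrier := {f | IsDyadicPL (Subtype.val : I → ℝ) f}
  mul_mem' hf hg := IsDyadicPL.mul hf hg (IsDyadicPL.preservesDyadic hg)
  one_mem' := IsDyadicPL.one
  inv_mem' hf := IsDyadicPL.inv hf (IsDyadicPL.preservesDyadic hf)

/-- The group `PL₂⁺(ℝ)` of increasing piecewise linear homeomorphisms of the real line which
preserve the dyadic rationals and have a discrete set of dyadic breakpoints and slopes which are
powers of `2`. -/
def PL2 : Subgroup (ℝ ≃o ℝ) where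
  carrier := {f | IsDyadicPL (id : ℝ → ℝ) f ∧ PreservesDyadic (id : ℝ → ℝ) f}
  mul_mem' hf hg := ⟨hf.1.mul hg.1 hg.2, hf.2.mul hg.2⟩
  one_mem' := ⟨IsDyadicPL.one, PreservesDyadic.one⟩
  inv_mem' hf := ⟨hf.1.inv hf.2, hf.2.inv⟩

theorem tendsto_top (f : ℝ ≃o ℝ) : Tendsto f atTop atTop := f.tendsto_atTop

theorem tendsto_bot (f : ℝ ≃o ℝ) : Tendsto f atBot atBot := f.tendsto_atBot

/-- `Aut⁺F`, as the group of those elements of `PL₂⁺(ℝ)` which commute with the translation by `1`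
outside some bounded interval. -/
def AutPlusF : Subgroup (ℝ ≃o ℝ) where
  carrier := {f | f ∈ PL2 ∧ (∀ᶠ x in atTop, f (x + 1) = f x + 1) ∧
    (∀ᶠ x in atBot, f (x + 1) = f x + 1)}
  mul_mem' := by
    rintro f g ⟨hf, hf1, hf2⟩ ⟨hg, hg1, hg2⟩
    refine ⟨mul_mem hf hg, ?_, ?_⟩
    · filter_upwards [hg1, (tendsto_top g).eventually hf1] with x h1 h2
      rw [RelIso.mul_apply, RelIso.mul_apply, h1, h2]
    · filter_upwards [hg2, (tendsto_bot g).eventually hf2] with x h1 h2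
      rw [RelIso.mul_apply, RelIso.mul_apply, h1, h2]
  one_mem' := ⟨one_mem _, Eventually.of_forall fun _ => rfl, Eventually.of_forall fun _ => rfl⟩
  inv_mem' := by
    rintro f ⟨hf, hf1, hf2⟩
    have hs : ∀ y, f (f⁻¹ y) = y := fun y => f.apply_symm_apply y
    refine ⟨inv_mem hf, ?_, ?_⟩
    · filter_upwards [(tendsto_top f⁻¹).eventually hf1] with x h1
      apply f.injective
      rw [hs, h1, hs]
    · filter_upwards [(tendsto_bot f⁻¹).eventually hf2] with x h1
      apply f.injective
      rw [hs, h1, hs]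

/-- `F_x`: the copy of `F` in `PL₂⁺(ℝ)` consisting of the elements which are translations by
integers near `+∞` and near `-∞`. -/
def Fx : Subgroup (ℝ ≃o ℝ) where
  carrier := {f | f ∈ PL2 ∧ (∃ k : ℤ, ∀ᶠ x in atTop, f x = x + k) ∧
    (∃ l : ℤ, ∀ᶠ x in atBot, f x = x + l)}
  mul_mem' := by
    rintro f g ⟨hf, ⟨k, hk⟩, ⟨l, hl⟩⟩ ⟨hg, ⟨k', hk'⟩, ⟨l', hl'⟩⟩
    refine ⟨mul_mem hf hg, ⟨k' + k, ?_⟩, ⟨l' + l, ?_⟩⟩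
    · filter_upwards [hk', (tendsto_top g).eventually hk] with x h1 h2
      rw [RelIso.mul_apply, h2, h1]
      push_cast
      ring
    · filter_upwards [hl', (tendsto_bot g).eventually hl] with x h1 h2
      rw [RelIso.mul_apply, h2, h1]
      push_cast
      ring
  one_mem' := ⟨one_mem _, ⟨0, Eventually.of_forall fun x => by simp⟩,
    ⟨0, Eventually.of_forall fun x => by simp⟩⟩
  inv_mem' := by
    rintro f ⟨hf, ⟨k, hk⟩, ⟨l, hl⟩⟩
    have hs : ∀ y, f (f⁻¹ y) = y := fun y => f.apply_symm_apply y
    refine ⟨inv_mem hf, ⟨-k, ?_⟩, ⟨-l, ?_⟩⟩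
    · filter_upwards [(tendsto_top f⁻¹).eventually hk] with x h1
      rw [hs] at h1
      push_cast
      linarith
    · filter_upwards [(tendsto_bot f⁻¹).eventually hl] with x h1
      rw [hs] at h1
      push_cast
      linarith

/-- The fractional part of a real number, as a point of the unit interval. -/
def fractI (x : ℝ) : I := ⟨Int.fract x, Int.fract_nonneg x, (Int.fract_lt_one x).le⟩

/-- The periodic extension: the graph of `g` is put into each box `[k, k + 1] × [k, k + 1]`. -/
def liftFun (g : I ≃o I) (x : ℝ) : ℝ := ⌊x⌋ + (g (fractI x) : ℝ)

theorem apply_fractI_lt_one (g : I ≃o I) (x : ℝ) : (g (fractI x) : ℝ) < 1 := by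
  have h1 : fractI x < ⊤ := Subtype.mk_lt_mk.2 (Int.fract_lt_one x)
  have h2 := g.strictMono h1
  rw [g.map_top] at h2
  exact h2

theorem floor_liftFun (g : I ≃o I) (x : ℝ) : ⌊liftFun g x⌋ = ⌊x⌋ := by
  have h : ⌊(g (fractI x) : ℝ)⌋ = 0 := Int.floor_eq_zero_iff.2
    ⟨(g (fractI x)).2.1, apply_fractI_lt_one g x⟩
  rw [liftFun, Int.floor_intCast_add, h, add_zero]

theorem fractI_liftFun (g : I ≃o I) (x : ℝ) : fractI (liftFun g x) = g (fractI x) := by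
  apply Subtype.ext
  change liftFun g x - ⌊liftFun g x⌋ = _
  rw [floor_liftFun, liftFun]
  ring

theorem liftFun_mul (f g : I ≃o I) (x : ℝ) : liftFun (f * g) x = liftFun f (liftFun g x) := by
  rw [liftFun, liftFun, floor_liftFun, fractI_liftFun, RelIso.mul_apply]

theorem liftFun_one (x : ℝ) : liftFun 1 x = x := Int.floor_add_fract x

theorem liftFun_add_int (g : I ≃o I) (x : ℝ) (n : ℤ) : liftFun g (x + n) = liftFun g x + n := by
  have h : fractI (x + n) = fractI x := Subtype.ext (Int.fract_add_intCast x n)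
  rw [liftFun, liftFun, h, Int.floor_add_intCast]
  push_cast
  ring

theorem liftFun_strictMono (g : I ≃o I) : StrictMono (liftFun g) := by
  intro x y hxy
  rcases (Int.floor_le_floor hxy.le).eq_or_lt with h | h
  · have h1 : fractI x < fractI y := by
      apply Subtype.mk_lt_mk.2
      rw [Int.fract, Int.fract, h]
      linarith
    have h2 : (g (fractI x) : ℝ) < g (fractI y) := g.strictMono h1
    rw [liftFun, liftFun, h]
    linarith
  · have h1 : (⌊x⌋ : ℝ) + 1 ≤ ⌊y⌋ := by exact_mod_cast h
    have h2 := apply_fractI_lt_one g x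
    have h3 := (g (fractI y)).2.1
    rw [liftFun, liftFun]
    linarith

/-- The periodic extension, as a homomorphism to the homeomorphisms of the real line. -/
def lift : (I ≃o I) →* (ℝ ≃o ℝ) where
  toFun g := (liftFun_strictMono g).orderIsoOfRightInverse (liftFun g) (liftFun g⁻¹)
    (fun x => by rw [← liftFun_mul, mul_inv_cancel, liftFun_one])
  map_one' := by ext x; exact liftFun_one x
  map_mul' f g := by ext x; exact liftFun_mul f g x

theorem lift_apply (g : I ≃o I) (x : ℝ) : lift g x = liftFun g x := rfl

/-- `F_w`: the copy of `F` which consists of the periodic extensions of its elements. -/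
def Fw : Subgroup (ℝ ≃o ℝ) := F.map lift

theorem circle_eq_iff {x y : ℝ} :
    (x : UnitAddCircle) = (y : UnitAddCircle) ↔ ∃ n : ℤ, x = y + n := by
  rw [← sub_eq_zero, ← AddCircle.coe_sub, AddCircle.coe_eq_zero_iff]
  refine exists_congr fun n => ?_
  rw [zsmul_eq_mul, mul_one, eq_sub_iff_add_eq', eq_comm]

theorem lift_congr (g : I ≃o I) {x y : ℝ} (h : (x : UnitAddCircle) = (y : UnitAddCircle)) :
    (lift g x : UnitAddCircle) = (lift g y : UnitAddCircle) := by
  obtain ⟨n, rfl⟩ := circle_eq_iff.1 h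
  exact circle_eq_iff.2 ⟨n, liftFun_add_int g y n⟩

/-- The group `C`, the preimage of the diagonal copy `{(g, g) | g ∈ F}` of `F` under the
homomorphism `Aut⁺F → T × T` which takes an element to the two homeomorphisms of the circle `ℝ / ℤ`
that it induces near `+∞` and near `-∞`. Here an element `g` of `F` is seen as an element of `T`,
the homeomorphism of the circle `ℝ / ℤ` which is induced by `lift g`. -/
def C : Subgroup (ℝ ≃o ℝ) where
  carrier := {f | f ∈ AutPlusF ∧ ∃ g ∈ F,
    (∀ᶠ x in atTop, (f x : UnitAddCircle) = (lift g x : UnitAddCircle)) ∧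
    (∀ᶠ x in atBot, (f x : UnitAddCircle) = (lift g x : UnitAddCircle))}
  mul_mem' := by
    rintro f f' ⟨hf, g, hg, h1, h2⟩ ⟨hf', g', hg', h1', h2'⟩
    refine ⟨mul_mem hf hf', g * g', mul_mem hg hg', ?_, ?_⟩
    · filter_upwards [h1', (tendsto_top f').eventually h1] with x e1 e2
      rw [map_mul, RelIso.mul_apply, RelIso.mul_apply, e2, lift_congr g e1]
    · filter_upwards [h2', (tendsto_bot f').eventually h2] with x e1 e2
      rw [map_mul, RelIso.mul_apply, RelIso.mul_apply, e2, lift_congr g e1]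
  one_mem' := ⟨one_mem _, 1, one_mem _, Eventually.of_forall fun x => by rw [map_one],
    Eventually.of_forall fun x => by rw [map_one]⟩
  inv_mem' := by
    rintro f ⟨hf, g, hg, h1, h2⟩
    have hs : ∀ y, f (f⁻¹ y) = y := fun y => f.apply_symm_apply y
    have hg' : ∀ y, lift g⁻¹ (lift g y) = y := fun y => by
      rw [← RelIso.mul_apply, ← map_mul, inv_mul_cancel, map_one, RelIso.one_apply]
    refine ⟨inv_mem hf, g⁻¹, inv_mem hg, ?_, ?_⟩
    · filter_upwards [(tendsto_top f⁻¹).eventually h1] with x e1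
      rw [hs] at e1
      rw [lift_congr g⁻¹ e1, hg']
    · filter_upwards [(tendsto_bot f⁻¹).eventually h2] with x e1
      rw [hs] at e1
      rw [lift_congr g⁻¹ e1, hg']

/-- The generator `x₀` of `F_x`, the translation by `1`. -/
def x0 : ℝ ≃o ℝ := OrderIso.addRight 1

/-- The map underlying the generator `x₁`. -/
def x1Fun (t : ℝ) : ℝ := if t ≤ 0 then t else if t ≤ 1 then 2 * t else t + 1

theorem x1Fun_strictMono : StrictMono x1Fun := by
  intro s t h
  unfold x1Fun
  split_ifs <;> linarith

/-- The generator `x₁` of `F_x`, with support `[0, ∞)`. -/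
def x1 : ℝ ≃o ℝ :=
  x1Fun_strictMono.orderIsoOfRightInverse x1Fun
    (fun t => if t ≤ 0 then t else if t ≤ 2 then t / 2 else t - 1)
    (fun t => by unfold x1Fun; dsimp only; split_ifs <;> linarith)

/-- The map underlying the first standard generator of `F`. -/
def g0Fun (t : ℝ) : ℝ := if t ≤ 1 / 4 then 2 * t else if t ≤ 1 / 2 then t + 1 / 4 else (t + 1) / 2

theorem g0Fun_strictMono : StrictMono g0Fun := by
  intro s t h
  unfold g0Fun
  split_ifs <;> linarith

/-- The first standard generator of `F` on the unit interval. -/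
def g0 : I ≃o I :=
  StrictMono.orderIsoOfRightInverse
    (fun t : I => (⟨g0Fun t, by
      obtain ⟨t, h1, h2⟩ := t
      constructor <;> dsimp only [g0Fun] <;> split_ifs <;> linarith⟩ : I))
    (fun _ _ h => g0Fun_strictMono h)
    (fun t : I => (⟨if (t : ℝ) ≤ 1 / 2 then t / 2 else if (t : ℝ) ≤ 3 / 4 then t - 1 / 4
        else 2 * t - 1, by
      obtain ⟨t, h1, h2⟩ := t
      constructor <;> dsimp only <;> split_ifs <;> linarith⟩ : I))
    (fun t => by
      obtain ⟨t, h1, h2⟩ := t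
      apply Subtype.ext
      dsimp only [g0Fun]
      split_ifs <;> linarith)

/-- The map underlying the second standard generator of `F`. -/
def g1Fun (t : ℝ) : ℝ :=
  if t ≤ 1 / 2 then t else if t ≤ 5 / 8 then 2 * t - 1 / 2
    else if t ≤ 3 / 4 then t + 1 / 8 else (t + 1) / 2

theorem g1Fun_strictMono : StrictMono g1Fun := by
  intro s t h
  unfold g1Fun
  split_ifs <;> linarith

/-- The second standard generator of `F` on the unit interval. -/
def g1 : I ≃o I :=
  StrictMono.orderIsoOfRightInverse
    (fun t : I => (⟨g1Fun t, by
      obtain ⟨t, h1, h2⟩ := t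
      constructor <;> dsimp only [g1Fun] <;> split_ifs <;> linarith⟩ : I))
    (fun _ _ h => g1Fun_strictMono h)
    (fun t : I => (⟨if (t : ℝ) ≤ 1 / 2 then t else if (t : ℝ) ≤ 3 / 4 then t / 2 + 1 / 4
        else if (t : ℝ) ≤ 7 / 8 then t - 1 / 8 else 2 * t - 1, by
      obtain ⟨t, h1, h2⟩ := t
      constructor <;> dsimp only <;> split_ifs <;> linarith⟩ : I))
    (fun t => by
      obtain ⟨t, h1, h2⟩ := t
      apply Subtype.ext
      dsimp only [g1Fun]
      split_ifs <;> linarith)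

/-- The generator `w₀` of `F_w`. -/
def w0 : ℝ ≃o ℝ := lift g0

/-- The generator `w₁` of `F_w`. -/
def w1 : ℝ ≃o ℝ := lift g1

/-- The four symbols on which the presentation is written. -/
inductive Gen : Type
  | x0 | x1 | w0 | w1

/-- The homeomorphism which a symbol stands for. -/
def Gen.toHomeo : Gen → (ℝ ≃o ℝ)
  | .x0 => ThompsonAut.x0
  | .x1 => ThompsonAut.x1
  | .w0 => ThompsonAut.w0
  | .w1 => ThompsonAut.w1

/-- The commutator. -/
def comm (a b : FreeGroup Gen) : FreeGroup Gen := a * b * a⁻¹ * b⁻¹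

/-- The two standard relators of `F` on `a` and `b`. -/
def relatorsF (a b : FreeGroup Gen) : Set (FreeGroup Gen) :=
  {comm (a * b⁻¹) (a⁻¹ * b * a), comm (a * b⁻¹) (a ^ (-2 : ℤ) * b * a ^ 2)}

/-- The two commutation relators and the two relators for the conjugates of `x₁`. -/
def relatorsAction (x₀ x₁ w₀ w₁ : FreeGroup Gen) : Set (FreeGroup Gen) :=
  {comm x₀ w₀, comm x₀ w₁,
    (w₀ * x₁ * w₀⁻¹) *
      (x₁ ^ 3 * x₀⁻¹ * x₁ * x₀ ^ (-3 : ℤ) * x₁ * x₀ * x₁ ^ (-2 : ℤ) * x₀ ^ 3 * x₁ ^ (-2 : ℤ))⁻¹,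
    (w₁ * x₁ * w₁⁻¹) *
      (x₁ ^ 2 * x₀⁻¹ * x₁ * x₀⁻¹ * x₁ * x₀ ^ (-2 : ℤ) * x₁ ^ 2 * x₀ ^ (-2 : ℤ) * x₁ * x₀ *
        x₁ ^ (-2 : ℤ) * x₀ * x₁⁻¹ * x₀ ^ 3 * x₁ ^ (-2 : ℤ) * x₀ * x₁⁻¹)⁻¹}

/-- The eight relators of the presentation. -/
def relatorsC : Set (FreeGroup Gen) :=
  relatorsF (.of .x0) (.of .x1) ∪ relatorsF (.of .w0) (.of .w1) ∪
    relatorsAction (.of .x0) (.of .x1) (.of .w0) (.of .w1)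

end

end ThompsonAut

/-! The decomposition. If `f` in `C` induces the same `g ∈ F` on the circle at both ends, then `f *
(lift g)⁻¹` induces the identity there. By continuity it is translation by one integer near each
end, so it lies in `Fx` (`exists_mul_lift`). An element of `Fx ∩ Fw` is periodic and is a
translation near `+∞`, hence a translation everywhere. It fixes `0`, so it is trivial. `Fx` is
normal because elements of `AutPlusF` commute with integer translations near both ends.

The presentation. In the abstract group let `X` and `W` be the subgroups generated by the symbols
for `x₀, x₁` and for `w₀, w₁`. Both map faithfully to homeomorphisms. The two relations of `F` yield
the infinite presentation `xₙ xₖ = xₖ xₙ₊₁` for `k < n`, so every element of `X` is a fraction `p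
q⁻¹` of positive words. The homeomorphism given by a positive word determines the exponent of its
smallest letter, so positive words with equal values can be cancelled against each other
(`ThompsonPair.lift_eq_one`). For `W`, words are carried to `x₀, x₁` by the conjugation `conjTheta`,
which turns `g0, g1` into `x0, x1`.

The last four relators conjugate the generators of `X` by `w₀` and `w₁` into `X`. No relator treats
conjugation by `w₀⁻¹` or `w₁⁻¹`; it is handled by the normality of `Fx` and the faithfulness of `X`
(`mem_normalizer_presentedX`). Hence `X` is normal and the whole group is `X W`. If `n w` maps to
`1`, the images of `n` and `w` lie in `Fx ∩ Fw = 1`, so `n = w = 1`.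

Surjectivity needs `x0, x1` to generate `Fx` (`closure_x0_x1`). Up to uniform subdivisions, an
element of `Fx` maps unit intervals onto standard dyadic intervals, and conjugates of `x1` merge
sibling intervals until only a translation is left. Conjugation by `theta` transfers this to `g0,
g1`, hence to `w0, w1`. -/

namespace ThompsonAut

/-! ### Two relations, the infinite presentation and positive words -/

section pair

variable {G : Type*} [Group G]

/-- The two defining relations of Thompson's group `F`, for elements `a`, `b` of a group. -/
structure ThompsonPair (a b : G) : Prop where
  commute_two : Commute (a * b⁻¹) (a⁻¹ * b * a)
  commute_three : Commute (a * b⁻¹) (a ^ (-2 : ℤ) * b * a ^ 2)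

/-- The generators `a, b, a⁻¹ b a, a⁻² b a², …` of the infinite presentation. -/
def gen (a b : G) : ℕ → G
  | 0 => a
  | n + 1 => (a ^ n)⁻¹ * b * a ^ n

theorem gen_zero (a b : G) : gen a b 0 = a := rfl

theorem gen_one (a b : G) : gen a b 1 = b := by simp [gen]

theorem gen_succ_add (a b : G) (n m : ℕ) :
    gen a b (n + 1 + m) = (a ^ m)⁻¹ * gen a b (n + 1) * a ^ m := by
  rw [add_right_comm, gen, gen, pow_add]
  group

theorem map_gen {H : Type*} [Group H] (φ : G →* H) (a b : G) (n : ℕ) :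
    φ (gen a b n) = gen (φ a) (φ b) n := by
  cases n <;> simp [gen]

/-- The value of a positive word in the generators `gen a b n`. -/
def posWord (a b : G) (l : List ℕ) : G := (l.map (gen a b)).prod

@[simp] theorem posWord_nil (a b : G) : posWord a b [] = 1 := rfl

@[simp] theorem posWord_cons (a b : G) (n : ℕ) (l : List ℕ) :
    posWord a b (n :: l) = gen a b n * posWord a b l := by simp [posWord]

theorem posWord_append (a b : G) (l m : List ℕ) :
    posWord a b (l ++ m) = posWord a b l * posWord a b m := by simp [posWord]

theorem map_posWord {H : Type*} [Group H] (φ : G →* H) (a b : G) (l : List ℕ) :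
    φ (posWord a b l) = posWord (φ a) (φ b) l := by
  induction l with
  | nil => simp
  | cons n l ih => simp [ih, map_gen]

variable {a b : G}

/-- Conjugation by `b` agrees with conjugation by `a` on whatever commutes with `a * b⁻¹`; the two
relations say this for the letters `2` and `3`. That suffices, since each later letter is the
conjugate of its predecessor by the letter before that. -/
theorem ThompsonPair.conj_one (h : ThompsonPair a b) (n : ℕ) :
    b⁻¹ * gen a b (n + 2) * b = gen a b (n + 3) := by
  have key : ∀ y : G, Commute (a * b⁻¹) y → b⁻¹ * y * b = a⁻¹ * y * a := by
    intro y hy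
    have e : a * b⁻¹ * y = y * (a * b⁻¹) := hy
    calc b⁻¹ * y * b = a⁻¹ * (a * b⁻¹ * y) * b := by group
      _ = a⁻¹ * y * a := by rw [e]; group
  have h2 : b⁻¹ * gen a b 2 * b = gen a b 3 := by
    have := key _ h.commute_two
    have e : gen a b 2 = a⁻¹ * b * a := by simp [gen]
    have e3 : gen a b 3 = (a ^ 1)⁻¹ * gen a b 2 * a ^ 1 := gen_succ_add a b 1 1
    rw [e3, e, this, pow_one]
  have h3 : b⁻¹ * gen a b 3 * b = gen a b 4 := by
    have := key _ h.commute_three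
    have e : gen a b 3 = a ^ (-2 : ℤ) * b * a ^ 2 := by
      rw [gen, zpow_neg, zpow_ofNat]
    have e3 : gen a b 4 = (a ^ 1)⁻¹ * gen a b 3 * a ^ 1 := gen_succ_add a b 2 1
    rw [e3, e, this, pow_one]
  -- This is `h2` conjugated by `a ^ m`.
  have shift : ∀ m, (gen a b (m + 1))⁻¹ * gen a b (m + 2) * gen a b (m + 1) = gen a b (m + 3) := by
    intro m
    have e1 := gen_succ_add a b 0 m
    have e2 := gen_succ_add a b 1 m
    have e3 := gen_succ_add a b 2 m
    rw [show m + 1 = 0 + 1 + m by ring, show m + 2 = 1 + 1 + m by ring,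
      show m + 3 = 2 + 1 + m by ring, e1, e2, e3, zero_add, gen_one, ← h2]
    group
  induction n using Nat.strong_induction_on with
  | _ n ih =>
    match n with
    | 0 => exact h2
    | 1 => exact h3
    | n + 2 =>
      have i1 := ih n (by omega)
      have i2 := ih (n + 1) (by omega)
      have s1 := shift (n + 1)
      have s2 := shift (n + 2)
      simp only [add_assoc, Nat.reduceAdd] at i1 i2 s1 s2 ⊢
      calc b⁻¹ * gen a b (n + 4) * b
          = (b⁻¹ * gen a b (n + 2) * b)⁻¹ * (b⁻¹ * gen a b (n + 3) * b)
            * (b⁻¹ * gen a b (n + 2) * b) := by rw [← s1]; group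
        _ = gen a b (n + 5) := by rw [i1, i2]; exact s2

/-- Conjugation by a power of `a` shifts all positive indices, which reduces `k > 0` to `k = 1`,
that is, to `conj_one`. For `k = 0` it is the definition of the letters. -/
theorem ThompsonPair.gen_mul_gen (h : ThompsonPair a b) {k n : ℕ} (hk : k < n) :
    gen a b n * gen a b k = gen a b k * gen a b (n + 1) := by
  obtain ⟨n, rfl⟩ : ∃ m, n = m + 1 := ⟨n - 1, by omega⟩
  cases k with
  | zero =>
    rw [gen_succ_add a b n 1, gen_zero, pow_one]
    group
  | succ m =>
    obtain ⟨j, rfl⟩ : ∃ j, n = j + 1 + m := ⟨n - 1 - m, by omega⟩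
    have e0 := gen_succ_add a b 0 m
    have e1 := gen_succ_add a b (j + 1) m
    have e2 := gen_succ_add a b (j + 2) m
    have e3 := h.conj_one j
    rw [show j + 1 + m + 1 = j + 1 + 1 + m by ring,
      show j + 1 + 1 + m + 1 = j + 2 + 1 + m by ring, show m + 1 = 0 + 1 + m by ring,
      e0, e1, e2, zero_add, gen_one, ← e3]
    group

theorem ThompsonPair.gen_mul_gen_pow (h : ThompsonPair a b) {k n : ℕ} (hk : k < n) (m : ℕ) :
    gen a b n * gen a b k ^ m = gen a b k ^ m * gen a b (n + m) := by
  induction m with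
  | zero => simp
  | succ m ih =>
    rw [pow_succ, ← mul_assoc, ih, mul_assoc, h.gen_mul_gen (by omega), ← mul_assoc]
    rfl

/-- An inverse of a generator can be moved to the right of a positive word. -/
theorem ThompsonPair.exists_inv_gen_mul (h : ThompsonPair a b) (l : List ℕ) (i : ℕ) :
    ∃ p q : List ℕ, (gen a b i)⁻¹ * posWord a b l = posWord a b p * (posWord a b q)⁻¹ := by
  induction l generalizing i with
  | nil => exact ⟨[], [i], by simp⟩
  | cons n l ih =>
    -- Writing `xᵢ` for `gen a b i`: `xᵢ⁻¹ xₙ` is `xₙ₊₁ xᵢ⁻¹` if `i < n`, is trivial if `i = n`, and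
    -- is `xₙ xᵢ₊₁⁻¹` if `n < i`. The index `i` may grow, so the induction runs over all `i`.
    rcases lt_trichotomy i n with hi | rfl | hi
    · obtain ⟨p, q, e⟩ := ih i
      refine ⟨(n + 1) :: p, q, ?_⟩
      rw [posWord_cons, posWord_cons, mul_assoc, ← e, ← mul_assoc, ← mul_assoc,
        inv_mul_eq_iff_eq_mul.2]
      rw [← mul_assoc, ← h.gen_mul_gen hi]
      group
    · exact ⟨l, [], by simp⟩
    · obtain ⟨p, q, e⟩ := ih (i + 1)
      refine ⟨n :: p, q, ?_⟩
      rw [posWord_cons, posWord_cons, mul_assoc, ← e, ← mul_assoc, ← mul_assoc]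
      congr 1
      rw [inv_mul_eq_iff_eq_mul, ← mul_assoc, h.gen_mul_gen hi]
      group

/-- Fractions of positive words are stable under left multiplication by a letter and, by
`exists_inv_gen_mul`, by the inverse of a letter. -/
theorem ThompsonPair.exists_eq_mul_inv (h : ThompsonPair a b) {g : G}
    (hg : g ∈ Subgroup.closure {a, b}) :
    ∃ p q : List ℕ, g = posWord a b p * (posWord a b q)⁻¹ := by
  have hgen : ∀ y ∈ ({a, b} : Set G), ∃ i, y = gen a b i := by
    rintro y (rfl | rfl)
    · exact ⟨0, rfl⟩
    · exact ⟨1, (gen_one _ _).symm⟩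
  induction hg using Subgroup.closure_induction_left with
  | one => exact ⟨[], [], by simp⟩
  | mul_left y hy z _ ih =>
    obtain ⟨i, rfl⟩ := hgen y hy
    obtain ⟨p, q, rfl⟩ := ih
    exact ⟨i :: p, q, by simp [mul_assoc]⟩
  | inv_mul_cancel y hy z _ ih =>
    obtain ⟨i, rfl⟩ := hgen y hy
    obtain ⟨p, q, rfl⟩ := ih
    obtain ⟨p', q', e⟩ := h.exists_inv_gen_mul p i
    exact ⟨p', q ++ q', by rw [← mul_assoc, e, posWord_append]; group⟩

/-- The occurrences of the smallest letter can be moved to the left of a positive word. -/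
theorem ThompsonPair.exists_pow_mul (h : ThompsonPair a b) (k : ℕ) (l : List ℕ)
    (hl : ∀ n ∈ l, k ≤ n) :
    ∃ (m : ℕ) (p : List ℕ), posWord a b l = gen a b k ^ m * posWord a b p ∧
      (∀ n ∈ p, k < n) ∧ m + p.length = l.length ∧ (k ∈ l → 0 < m) := by
  induction l with
  | nil => exact ⟨0, [], by simp⟩
  | cons n l ih =>
    obtain ⟨m, p, e, h1, h2, h3⟩ := ih fun n hn => hl n (List.mem_cons_of_mem _ hn)
    rcases (hl n List.mem_cons_self).eq_or_lt with rfl | hn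
    · refine ⟨m + 1, p, ?_, h1, ?_, fun _ => m.succ_pos⟩
      · rw [posWord_cons, e, pow_succ', mul_assoc]
      · rw [List.length_cons, ← h2]; ring
    · refine ⟨m, (n + m) :: p, ?_, ?_, ?_, ?_⟩
      · rw [posWord_cons, e, ← mul_assoc, h.gen_mul_gen_pow hn, posWord_cons, mul_assoc]
      · intro j hj
        rcases List.mem_cons.1 hj with rfl | hj
        · omega
        · exact h1 j hj
      · rw [List.length_cons, List.length_cons, ← h2]; ring
      · intro hk
        rcases List.mem_cons.1 hk with rfl | hk
        · exact absurd hn (lt_irrefl _)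
        · exact h3 hk

/-- Let `c`, `d` be elements of a group in which the exponent of the smallest letter of a positive
word is determined by the value of the word. Then positive words which have the same value on `c`
and `d` have the same value on all pairs that satisfy the relations of Thompson's group. -/
theorem ThompsonPair.posWord_eq (h : ThompsonPair a b) {H : Type*} [Group H] {c d : H}
    (hcd : ∀ (k m m' : ℕ) (p p' : List ℕ), (∀ n ∈ p, k < n) → (∀ n ∈ p', k < n) →
      gen c d k ^ m * posWord c d p = gen c d k ^ m' * posWord c d p' → m = m')
    (φ : G →* H) (hc : φ a = c) (hd : φ b = d)
    (p q : List ℕ) (e : posWord c d p = posWord c d q) : posWord a b p = posWord a b q := by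
  obtain ⟨N, hN⟩ : ∃ N, p.length + q.length = N := ⟨_, rfl⟩
  induction N using Nat.strong_induction_on generalizing p q with
  | _ N ih =>
    by_cases hne : ∃ k, k ∈ p ++ q
    · classical
      obtain ⟨hk, hmin⟩ : Nat.find hne ∈ p ++ q ∧ ∀ n ∈ p ++ q, Nat.find hne ≤ n :=
        ⟨Nat.find_spec hne, fun n hn => Nat.find_min' hne hn⟩
      generalize Nat.find hne = k at hk hmin
      obtain ⟨m, p', e1, h1, h2, h3⟩ := h.exists_pow_mul k p
        fun n hn => hmin n (List.mem_append_left _ hn)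
      obtain ⟨m', q', e2, h1', h2', h3'⟩ := h.exists_pow_mul k q
        fun n hn => hmin n (List.mem_append_right _ hn)
      -- The rewriting is done in `G` and pushed to `H` by `φ`, so the exponents compared in `H` are
      -- those found in `G`.
      have e1' := congrArg φ e1
      have e2' := congrArg φ e2
      simp only [map_mul, map_pow, map_posWord, map_gen, hc, hd] at e1' e2'
      have e3 := e
      rw [e1', e2'] at e3
      obtain rfl := hcd k m m' p' q' h1 h1' e3
      -- The letter `k` occurs in one of the words, so the common exponent is positive and
      -- cancelling the power shortens the words.
      have hm : 0 < m := (List.mem_append.1 hk).elim h3 h3'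
      rw [e1, e2, ih (p'.length + q'.length) (by omega) p' q' (mul_left_cancel e3) rfl]
    · have hp : p = [] := List.eq_nil_iff_forall_not_mem.2
        fun k hk => hne ⟨k, List.mem_append_left _ hk⟩
      have hq : q = [] := List.eq_nil_iff_forall_not_mem.2
        fun k hk => hne ⟨k, List.mem_append_right _ hk⟩
      rw [hp, hq]

end pair

/-! ### The homeomorphisms `x0`, `x1` and the presentation of Thompson's group -/

open MulOpposite

theorem thompsonPair_iff {G : Type*} [Group G] {a b : G} : ThompsonPair a b ↔
    a * b⁻¹ * (a⁻¹ * b * a) * (a * b⁻¹)⁻¹ * (a⁻¹ * b * a)⁻¹ = 1 ∧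
    a * b⁻¹ * (a ^ (-2 : ℤ) * b * a ^ 2) * (a * b⁻¹)⁻¹ * (a ^ (-2 : ℤ) * b * a ^ 2)⁻¹ = 1 := by
  rw [mul_inv_eq_one, mul_inv_eq_iff_eq_mul, mul_inv_eq_one, mul_inv_eq_iff_eq_mul]
  exact ⟨fun h => ⟨h.1, h.2⟩, fun h => ⟨h.1, h.2⟩⟩

theorem x0_apply (t : ℝ) : x0 t = t + 1 := rfl

theorem x0_inv_apply (t : ℝ) : x0⁻¹ t = t - 1 := rfl

theorem x0_pow_apply (n : ℕ) (t : ℝ) : (x0 ^ n) t = t + n := by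
  induction n generalizing t with
  | zero => simp
  | succ n ih =>
    rw [pow_succ, RelIso.mul_apply, ih, x0_apply]
    push_cast
    ring

theorem x0_pow_inv_apply (n : ℕ) (t : ℝ) : (x0 ^ n)⁻¹ t = t - n := by
  apply (x0 ^ n).injective
  rw [RelIso.apply_inv_self, x0_pow_apply]
  ring

theorem x1_of_le_zero {t : ℝ} (h : t ≤ 0) : x1 t = t := if_pos h

theorem x1_of_mem {t : ℝ} (h : 0 ≤ t) (h' : t ≤ 1) : x1 t = 2 * t := by
  change x1Fun t = _
  unfold x1Fun
  split_ifs <;> linarith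

theorem x1_of_one_le {t : ℝ} (h : 1 ≤ t) : x1 t = t + 1 := by
  change x1Fun t = _
  unfold x1Fun
  split_ifs <;> linarith

theorem x1_inv_of_le_zero {t : ℝ} (h : t ≤ 0) : x1⁻¹ t = t := by
  apply x1.injective
  rw [RelIso.apply_inv_self, x1_of_le_zero h]

theorem x1_inv_of_mem {t : ℝ} (h : 0 ≤ t) (h' : t ≤ 2) : x1⁻¹ t = t / 2 := by
  apply x1.injective
  rw [RelIso.apply_inv_self, x1_of_mem (by linarith) (by linarith)]
  ring

theorem x1_inv_of_two_le {t : ℝ} (h : 2 ≤ t) : x1⁻¹ t = t - 1 := by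
  apply x1.injective
  rw [RelIso.apply_inv_self, x1_of_one_le (by linarith)]
  ring

/-- In the opposite group the left factor acts first, so the letter `n + 1` is `x1` moved to the
right by `n`, with support `[n, ∞)`. -/
theorem unop_gen_succ_apply (n : ℕ) (t : ℝ) :
    unop (gen (op x0) (op x1) (n + 1)) t = x1 (t - n) + n := by
  simp only [gen, unop_mul, unop_inv, unop_pow, MulOpposite.unop_op, RelIso.mul_apply,
    x0_pow_inv_apply, x0_pow_apply]

theorem unop_gen_of_le {n : ℕ} {t : ℝ} (h : t ≤ n) : unop (gen (op x0) (op x1) (n + 1)) t = t := by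
  rw [unop_gen_succ_apply, x1_of_le_zero (by linarith)]
  ring

/-- The supports are separated: `x0` followed by `x1⁻¹` is the identity on `[1, ∞)`, and the letters
from `2` on are the identity on `(-∞, 1]`. -/
theorem thompsonPair_x0_x1 : ThompsonPair (op x0) (op x1) := by
  have key : ∀ n : ℕ, Commute (op x0 * (op x1)⁻¹) (gen (op x0) (op x1) (n + 2)) := by
    intro n
    apply unop_injective
    ext t
    set y := unop (gen (op x0) (op x1) (n + 2))
    have hy : ∀ t : ℝ, t ≤ 1 → y t = t := fun t ht => unop_gen_of_le (by push_cast; linarith)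
    simp only [unop_mul, unop_inv, MulOpposite.unop_op, RelIso.mul_apply, x0_apply]
    rcases le_total t 1 with ht | ht
    · have h1 : x1⁻¹ (t + 1) ≤ 1 := by
        have : x1⁻¹ (t + 1) ≤ x1⁻¹ 2 := x1⁻¹.monotone (by linarith)
        rw [x1_inv_of_two_le le_rfl] at this
        linarith
      change y (x1⁻¹ (t + 1)) = x1⁻¹ (y t + 1)
      rw [hy t ht, hy _ h1]
    · have h1 : 1 ≤ y t := by
        rw [← hy 1 le_rfl]
        exact y.monotone ht
      change y (x1⁻¹ (t + 1)) = x1⁻¹ (y t + 1)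
      rw [x1_inv_of_two_le (by linarith), x1_inv_of_two_le (by linarith)]
      simp
  refine ⟨?_, ?_⟩
  · simpa [gen] using key 0
  · have := key 1
    rwa [gen, ← zpow_natCast, ← zpow_neg] at this

theorem unop_posWord_apply {l : List ℕ} {k : ℕ} (hl : ∀ n ∈ l, k < n) {t : ℝ} (ht : t ≤ k) :
    unop (posWord (op x0) (op x1) l) t = t := by
  induction l with
  | nil => rfl
  | cons n l ih =>
    obtain ⟨m, rfl⟩ : ∃ m, n = m + 1 := ⟨n - 1, by have := hl n List.mem_cons_self; omega⟩
    have hkm : (k : ℝ) ≤ m := by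
      exact_mod_cast Nat.lt_succ_iff.1 (hl (m + 1) List.mem_cons_self)
    rw [posWord_cons, unop_mul, RelIso.mul_apply, unop_gen_of_le (ht.trans hkm)]
    exact ih fun n hn => hl n (List.mem_cons_of_mem _ hn)

/-- The exponent can be read off as the slope `2 ^ m` to the right of the fixed point `k`. -/
theorem unop_gen_pow_apply (k m : ℕ) {t : ℝ} (ht : 0 ≤ t) (h : 2 ^ m * t ≤ 1) :
    unop (gen (op x0) (op x1) (k + 1) ^ m) (k + t) = k + 2 ^ m * t := by
  induction m with
  | zero => simp
  | succ m ih =>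
    have h0 : 0 ≤ 2 ^ m * t := by positivity
    rw [pow_succ] at h
    rw [pow_succ, unop_mul, RelIso.mul_apply, ih (by linarith), unop_gen_succ_apply,
      x1_of_mem (by linarith) (by linarith), pow_succ]
    ring

/-- In the group of homeomorphisms of the line, the exponent of the smallest letter of a positive
word is determined by its value. -/
theorem exponent_unique (k m m' : ℕ) (p p' : List ℕ) (hp : ∀ n ∈ p, k < n) (hp' : ∀ n ∈ p', k < n)
    (e : gen (op x0) (op x1) k ^ m * posWord (op x0) (op x1) p =
      gen (op x0) (op x1) k ^ m' * posWord (op x0) (op x1) p') : m = m' := by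
  have e' := fun t : ℝ => congrArg (fun f : (ℝ ≃o ℝ)ᵐᵒᵖ => unop f t) e
  simp only [unop_mul, RelIso.mul_apply] at e'
  cases k with
  | zero =>
    have hm : (0 : ℝ) ≤ m := m.cast_nonneg
    have hm' : (0 : ℝ) ≤ m' := m'.cast_nonneg
    -- Translation by `m` or `m'` leaves this point in `(-∞, 0]`, where the letters above `0` act
    -- trivially.
    have h := e' (-m - m')
    simp only [gen_zero, unop_pow, MulOpposite.unop_op, x0_pow_apply] at h
    rw [unop_posWord_apply hp (by push_cast; linarith),
      unop_posWord_apply hp' (by push_cast; linarith)] at h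
    have : (m : ℝ) = m' := by linarith
    exact_mod_cast this
  | succ k =>
    -- The test point is `k + 2 ^ (-(m + m'))`: after `m` or `m'` doublings it is still in `[k, k +
    -- 1]`, which the letters above `k + 1` fix pointwise.
    have hpos : (0 : ℝ) < (2 ^ (m + m'))⁻¹ := by positivity
    have h1 : (2 : ℝ) ^ m * (2 ^ (m + m'))⁻¹ ≤ 1 := by
      rw [← div_eq_mul_inv]
      exact div_le_one_of_le₀ (pow_le_pow_right₀ (by norm_num) (by omega)) (by positivity)
    have h2 : (2 : ℝ) ^ m' * (2 ^ (m + m'))⁻¹ ≤ 1 := by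
      rw [← div_eq_mul_inv]
      exact div_le_one_of_le₀ (pow_le_pow_right₀ (by norm_num) (by omega)) (by positivity)
    have h := e' (k + (2 ^ (m + m'))⁻¹)
    rw [unop_gen_pow_apply k m hpos.le h1, unop_gen_pow_apply k m' hpos.le h2,
      unop_posWord_apply hp (by push_cast; linarith),
      unop_posWord_apply hp' (by push_cast; linarith), add_left_cancel_iff,
      mul_left_inj' hpos.ne'] at h
    exact pow_right_injective₀ (by norm_num) (by norm_num) h

/-- The two relators of Thompson's group on two symbols. -/
def relatorsPair : Set (FreeGroup Bool) :=
  let a := FreeGroup.of true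
  let b := FreeGroup.of false
  {a * b⁻¹ * (a⁻¹ * b * a) * (a * b⁻¹)⁻¹ * (a⁻¹ * b * a)⁻¹,
    a * b⁻¹ * (a ^ (-2 : ℤ) * b * a ^ 2) * (a * b⁻¹)⁻¹ * (a ^ (-2 : ℤ) * b * a ^ 2)⁻¹}

theorem ThompsonPair.lift_relatorsPair {G : Type*} [Group G] {a b : G} (h : ThompsonPair a b) :
    ∀ r ∈ relatorsPair, FreeGroup.lift (fun i => cond i a b) r = 1 := by
  obtain ⟨h1, h2⟩ := thompsonPair_iff.1 h
  rintro r (rfl | rfl)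
  · simpa only [map_mul, map_inv, FreeGroup.lift_apply_of, cond] using h1
  · simpa only [map_mul, map_inv, map_pow, map_zpow, FreeGroup.lift_apply_of, cond] using h2

/-- The presentation of Thompson's group: a word that is trivial on `x0`, `x1` is trivial on every
pair which satisfies the two relations. -/
theorem ThompsonPair.lift_eq_one {G : Type*} [Group G] {a b : G} (h : ThompsonPair a b)
    (u : FreeGroup Bool)
    (hu : FreeGroup.lift (fun i => cond i (op x0) (op x1)) u = 1) :
    FreeGroup.lift (fun i => cond i a b) u = 1 := by
  let A : FreeGroup Bool := .of true
  let B : FreeGroup Bool := .of false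
  -- The cancellation argument needs a homomorphism onto the concrete pair, which `G` need not have.
  -- It is therefore run in the universal group, and the result is then mapped to `G`.
  let π : FreeGroup Bool →* PresentedGroup relatorsPair := PresentedGroup.mk relatorsPair
  have hR : ThompsonPair (π A) (π B) := by
    rw [thompsonPair_iff]
    simp only [← map_mul, ← map_inv, ← map_zpow, ← map_pow]
    exact ⟨PresentedGroup.one_of_mem (Or.inl rfl), PresentedGroup.one_of_mem (Or.inr rfl)⟩
  let φ := PresentedGroup.toGroup thompsonPair_x0_x1.lift_relatorsPair
  let ψ := PresentedGroup.toGroup h.lift_relatorsPair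
  have hφ : ∀ v, φ (π v) = FreeGroup.lift (fun i => cond i (op x0) (op x1)) v := fun _ => rfl
  have hψ : ∀ v, ψ (π v) = FreeGroup.lift (fun i => cond i a b) v := fun _ => rfl
  have hmem : π u ∈ Subgroup.closure {π A, π B} := by
    have : u ∈ Subgroup.closure (range (FreeGroup.of : Bool → _)) := by
      rw [FreeGroup.closure_range_of]; trivial
    have h2 := Subgroup.mem_map_of_mem π this
    rw [MonoidHom.map_closure] at h2
    refine Subgroup.closure_mono ?_ h2
    rintro _ ⟨_, ⟨i, rfl⟩, rfl⟩
    cases i <;> simp [A, B]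
  obtain ⟨p, q, e⟩ := hR.exists_eq_mul_inv hmem
  have hA : φ (π A) = op x0 := by rw [hφ]; simp [A]
  have hB : φ (π B) = op x1 := by rw [hφ]; simp [B]
  have hpq : posWord (op x0) (op x1) p = posWord (op x0) (op x1) q := by
    have h3 := congrArg φ e
    rw [hφ, hu, map_mul, map_inv, map_posWord, map_posWord, hA, hB] at h3
    exact (mul_inv_eq_one.1 h3.symm)
  have h4 := hR.posWord_eq exponent_unique φ hA hB p q hpq
  rw [h4, mul_inv_cancel] at e
  rw [← hψ, e, map_one]

/-! ### Dyadic numbers and membership of the generators in `Fx` -/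

theorem isDyadic_intCast (k : ℤ) : IsDyadic k := ⟨k, 0, by simp⟩

theorem isDyadic_add_int_iff {x : ℝ} (k : ℤ) : IsDyadic (x + k) ↔ IsDyadic x :=
  ⟨fun h => by simpa using h.sub (isDyadic_intCast k), fun h => h.add (isDyadic_intCast k)⟩

theorem isDyadic_zpow_mul_iff {x : ℝ} (k : ℤ) : IsDyadic ((2 : ℝ) ^ k * x) ↔ IsDyadic x := by
  refine ⟨fun h => ?_, fun h => h.zpow_mul k⟩
  have := h.zpow_mul (-k)
  rwa [zpow_neg, inv_mul_cancel_left₀ (by positivity)] at this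

theorem x0_mem_PL2 : x0 ∈ PL2 := by
  refine ⟨⟨∅, by simp, by simp, fun a b _ _ => ⟨0, 1, fun y _ => ?_⟩⟩, fun x => ?_⟩
  · simp [x0_apply]
  · simpa [x0_apply] using isDyadic_add_int_iff (x := x) 1

theorem x1_mem_PL2 : x1 ∈ PL2 := by
  refine ⟨⟨{0, 1}, ?_, fun a b => (toFinite _).inter_of_left _, fun a b hab h => ?_⟩, fun x => ?_⟩
  · rintro b (rfl | rfl)
    · simpa using isDyadic_intCast 0
    · simpa using isDyadic_intCast 1
  · have h0 : ¬(a < 0 ∧ 0 < b) := fun h' => disjoint_left.1 h (Or.inl rfl) h'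
    have h1 : ¬(a < 1 ∧ 1 < b) := fun h' => disjoint_left.1 h (Or.inr rfl) h'
    rw [not_and_or, not_lt, not_lt] at h0 h1
    rcases h0 with h0 | h0
    · rcases h1 with h1 | h1
      · exact ⟨0, 1, fun y hy => by simp [x1_of_one_le (h1.trans hy.1)]⟩
      · exact ⟨1, 0, fun y hy => by simp [x1_of_mem (h0.trans hy.1) (hy.2.trans h1)]⟩
    · exact ⟨0, 0, fun y hy => by simp [x1_of_le_zero (hy.2.trans h0)]⟩
  · rcases le_total x 0 with h0 | h0
    · simp [x1_of_le_zero h0]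
    · rcases le_total x 1 with h1 | h1
      · simpa [x1_of_mem h0 h1] using isDyadic_zpow_mul_iff (x := x) 1
      · simpa [x1_of_one_le h1] using isDyadic_add_int_iff (x := x) 1

theorem x0_mem_Fx : x0 ∈ Fx :=
  ⟨x0_mem_PL2, ⟨1, .of_forall fun x => by simp [x0_apply]⟩,
    ⟨1, .of_forall fun x => by simp [x0_apply]⟩⟩

theorem x1_mem_Fx : x1 ∈ Fx := by
  refine ⟨x1_mem_PL2, ⟨1, ?_⟩, ⟨0, ?_⟩⟩
  · filter_upwards [eventually_ge_atTop 1] with x hx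
    simp [x1_of_one_le hx]
  · filter_upwards [eventually_le_atBot 0] with x hx
    simp [x1_of_le_zero hx]

theorem x0_zpow_apply (k : ℤ) (t : ℝ) : (x0 ^ k) t = t + k := by
  obtain ⟨n, rfl | rfl⟩ := k.eq_nat_or_neg
  · simp [x0_pow_apply]
  · simp [x0_pow_inv_apply, sub_eq_add_neg]

/-- The conjugate of `x1` with support `[k, ∞)`. -/
theorem conj_x1_apply (k : ℤ) (t : ℝ) : (x0 ^ k * x1 * (x0 ^ k)⁻¹) t = x1 (t - k) + k := by
  rw [RelIso.mul_apply, RelIso.mul_apply, x0_zpow_apply, ← zpow_neg, x0_zpow_apply]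
  push_cast
  rfl

/-! ### Generation of `Fx` by `x0`, `x1` through dyadic subdivisions -/

/-- The homeomorphism `φ` maps the intervals between consecutive integers affinely to standard
dyadic intervals, almost all of which have integral endpoints. -/
structure IsDyadicSubdivision (φ : ℝ ≃o ℝ) : Prop where
  affine : ∀ n : ℤ, ∃ (i : ℕ) (m : ℤ), ∀ t ∈ Icc (0 : ℝ) 1, φ (n + t) = (m + t) / 2 ^ i
  finite : {x : ℝ | (∃ n : ℤ, φ n = x) ∧ ∀ k : ℤ, x ≠ k}.Finite

theorem exists_common_level {S : Set ℝ} (hS : S.Finite) (h : ∀ s ∈ S, IsDyadic s) :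
    ∃ J : ℕ, ∀ s ∈ S, ∃ m : ℤ, 2 ^ J * s = m := by
  induction S, hS using Set.Finite.induction_on with
  | empty => exact ⟨0, by simp⟩
  | @insert a S _ _ ih =>
    obtain ⟨J, hJ⟩ := ih fun s hs => h s (mem_insert_of_mem _ hs)
    obtain ⟨m, n, rfl⟩ := h a (mem_insert _ _)
    refine ⟨J + n, ?_⟩
    rintro s (rfl | hs)
    · exact ⟨2 ^ J * m, by push_cast; rw [pow_add]; field_simp⟩
    · obtain ⟨m', e⟩ := hJ s hs
      exact ⟨2 ^ n * m', by push_cast; rw [← e]; ring⟩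

/-- The image of a unit interval has length `1 / 2 ^ i` and integral endpoints, hence length `1`. So
`φ` is translation by the integer `φ 0`. -/
theorem IsDyadicSubdivision.mem_closure_of_integral {φ : ℝ ≃o ℝ} (h : IsDyadicSubdivision φ)
    (hi : ∀ n : ℤ, ∃ k : ℤ, φ n = k) : φ ∈ Subgroup.closure {x0, x1} := by
  have h1 : ∀ (n : ℤ), ∀ t ∈ Icc (0 : ℝ) 1, φ (n + t) = φ n + t := by
    intro n
    obtain ⟨i, m, e⟩ := h.affine n
    obtain ⟨k, hk⟩ := hi n
    obtain ⟨l, hl⟩ := hi (n + 1)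
    have e0 := e 0 (by simp)
    have e1 := e 1 (by simp)
    rw [add_zero, add_zero] at e0
    push_cast at hl
    have hd : ((l - k : ℤ) : ℝ) = 1 / 2 ^ i := by
      push_cast
      rw [← hl, ← hk, e0, e1]
      ring
    have hi0 : i = 0 := by
      by_contra hne
      have h2 : (1 : ℝ) / 2 ^ i < 1 := by
        rw [div_lt_one (by positivity)]
        exact one_lt_pow₀ (by norm_num) hne
      have h3 : (0 : ℝ) < 1 / 2 ^ i := by positivity
      rw [← hd] at h2 h3
      have h4 : l - k < 1 := by exact_mod_cast h2
      have h5 : 0 < l - k := by exact_mod_cast h3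
      omega
    intro t ht
    rw [e t ht, e0, hi0]
    ring
  have h2 : ∀ n : ℤ, φ n = n + φ 0 := by
    intro n
    induction n using Int.induction_on with
    | zero => simp
    | succ n ih =>
      have := h1 n 1 (by simp)
      push_cast at this ih ⊢
      rw [this, ih]
      ring
    | pred n ih =>
      have := h1 (-n - 1) 1 (by simp)
      push_cast at this ih ⊢
      rw [sub_add_cancel, ih] at this
      linarith
  obtain ⟨k, hk⟩ := hi 0
  have h3 : φ = x0 ^ k := by
    ext x
    have e1 := h1 ⌊x⌋ (Int.fract x) ⟨Int.fract_nonneg x, (Int.fract_lt_one x).le⟩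
    rw [Int.floor_add_fract, h2] at e1
    push_cast at hk
    rw [e1, hk, x0_zpow_apply]
    linarith [Int.floor_add_fract x]
  rw [h3]
  exact zpow_mem (Subgroup.subset_closure (mem_insert _ _)) k

/-- A point of maximal level of a subdivision is the midpoint of a standard dyadic interval which
is the union of two neighbouring intervals of the subdivision. -/
theorem IsDyadicSubdivision.exists_siblings {φ : ℝ ≃o ℝ} (h : IsDyadicSubdivision φ)
    (hi : ¬∀ n : ℤ, ∃ k : ℤ, φ n = k) :
    ∃ (n : ℤ) (j : ℕ) (q : ℤ), (∀ t ∈ Icc (0 : ℝ) 2, φ (n + t) = (2 * q + t) / 2 ^ (j + 1)) ∧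
      ∀ k : ℤ, φ (n + 1) ≠ k := by
  classical
  have hex : ∃ J : ℕ, ∀ n : ℤ, ∃ m : ℤ, 2 ^ J * φ n = m := by
    obtain ⟨J, hJ⟩ := exists_common_level h.finite (by
      rintro _ ⟨⟨n, rfl⟩, -⟩
      obtain ⟨i, m, e⟩ := h.affine n
      have := e 0 (by simp)
      simp only [add_zero] at this
      exact ⟨m, i, this⟩)
    refine ⟨J, fun n => ?_⟩
    by_cases hn : ∀ k : ℤ, φ n ≠ k
    · exact hJ _ ⟨⟨n, rfl⟩, hn⟩
    · push Not at hn
      obtain ⟨k, hk⟩ := hn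
      exact ⟨2 ^ J * k, by rw [hk]; push_cast; rfl⟩
  -- `J` is the least level at which all division points are multiples of `1 / 2 ^ J`. It is
  -- positive, because some division point is not an integer.
  have hJ := Nat.find_spec hex
  have hmin := fun j => Nat.find_min hex (m := j)
  generalize Nat.find hex = J at hJ hmin
  obtain ⟨j, rfl⟩ : ∃ j, J = j + 1 := by
    refine ⟨J - 1, ?_⟩
    rcases J.eq_zero_or_pos with rfl | hpos
    · exact absurd (fun n => by simpa using hJ n) hi
    · omega
  have hj := hmin j j.lt_succ_self
  push Not at hj
  obtain ⟨N, hN⟩ := hj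
  -- Both intervals that meet at `φ N` have level exactly `j + 1`. A lower level would make `φ N` a
  -- multiple of `1 / 2 ^ j`; a higher one would put two multiples of `1 / 2 ^ (j + 1)` too close
  -- together.
  have level : ∀ (n : ℤ) (i : ℕ) (m : ℤ), (∀ t ∈ Icc (0 : ℝ) 1, φ (n + t) = (m + t) / 2 ^ i) →
      (n = N ∨ n + 1 = N) → i = j + 1 := by
    intro n i m e hn
    have e0 := e 0 (by simp)
    have e1 := e 1 (by simp)
    rw [add_zero, add_zero] at e0
    have hlow : j < i := by
      by_contra hle
      obtain ⟨d, rfl⟩ : ∃ d, j = i + d := ⟨j - i, by omega⟩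
      rcases hn with rfl | rfl
      · refine hN (2 ^ d * m) ?_
        rw [e0]
        push_cast
        rw [pow_add]
        field_simp
      · refine hN (2 ^ d * (m + 1)) ?_
        push_cast
        rw [e1, pow_add]
        field_simp
    by_contra hne
    obtain ⟨d, rfl⟩ : ∃ d, i = j + 1 + (d + 1) := ⟨i - j - 2, by omega⟩
    obtain ⟨a, ha⟩ := hJ n
    obtain ⟨b, hb⟩ := hJ (n + 1)
    push_cast at hb
    have hd : ((b - a : ℤ) : ℝ) = 1 / 2 ^ (d + 1) := by
      push_cast
      rw [← ha, ← hb, e0, e1, pow_add]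
      field_simp
      ring
    have h2 : (1 : ℝ) / 2 ^ (d + 1) < 1 := by
      rw [div_lt_one (by positivity)]
      exact one_lt_pow₀ (by norm_num) (by omega)
    have h3 : (0 : ℝ) < 1 / 2 ^ (d + 1) := by positivity
    rw [← hd] at h2 h3
    have h4 : b - a < 1 := by exact_mod_cast h2
    have h5 : 0 < b - a := by exact_mod_cast h3
    omega
  obtain ⟨i, m, e⟩ := h.affine (N - 1)
  obtain ⟨i', m', e'⟩ := h.affine N
  obtain rfl := level _ _ _ e (Or.inr (by ring))
  obtain rfl := level _ _ _ e' (Or.inl rfl)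
  have e1 := e 1 (by simp)
  have e0 := e' 0 (by simp)
  push_cast at e1
  rw [sub_add_cancel] at e1
  rw [add_zero, add_zero, e1, div_left_inj' (by positivity)] at e0
  -- This parity makes the two neighbours siblings, the halves of one standard dyadic interval. For
  -- odd `m` the point `φ N` would again be a multiple of `1 / 2 ^ j`.
  have hm : Even m := by
    by_contra hodd
    obtain ⟨r, rfl⟩ := Int.not_even_iff_odd.1 hodd
    refine hN (r + 1) ?_
    rw [e1, pow_succ]
    push_cast
    field_simp
    ring
  obtain ⟨q, rfl⟩ := hm
  refine ⟨N - 1, j, q, ?_, ?_⟩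
  · rintro t ⟨h0, h2⟩
    rcases le_total t 1 with h1 | h1
    · rw [e t ⟨h0, h1⟩]
      push_cast
      ring
    · have := e' (t - 1) ⟨by linarith, by linarith⟩
      rw [← e0] at this
      push_cast at this ⊢
      rw [show (N : ℝ) - 1 + t = N + (t - 1) by ring, this]
      ring
  · intro k hk
    push_cast at hk
    rw [sub_add_cancel] at hk
    refine hN (2 ^ j * k) ?_
    rw [hk]
    push_cast
    rfl

/-- Induction on the number of non-integral division points. Precomposing with the conjugate of `x1`
supported on `[N, ∞)` merges two sibling intervals and removes their common endpoint `φ (N + 1)`;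
the other division points remain. -/
theorem IsDyadicSubdivision.mem_closure {φ : ℝ ≃o ℝ} (h : IsDyadicSubdivision φ) :
    φ ∈ Subgroup.closure {x0, x1} := by
  obtain ⟨c, hc⟩ : ∃ c, {x : ℝ | (∃ n : ℤ, φ n = x) ∧ ∀ k : ℤ, x ≠ k}.ncard = c := ⟨_, rfl⟩
  induction c using Nat.strong_induction_on generalizing φ with
  | _ c ih =>
    by_cases hi : ∀ n : ℤ, ∃ k : ℤ, φ n = k
    · exact h.mem_closure_of_integral hi
    obtain ⟨N, j, q, e, hN⟩ := h.exists_siblings hi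
    set τ := x0 ^ N * x1 * (x0 ^ N)⁻¹ with hτ
    have hτmem : τ ∈ Subgroup.closure {x0, x1} := by
      have h0 : x0 ∈ Subgroup.closure {x0, x1} := Subgroup.subset_closure (Or.inl rfl)
      have h1 : x1 ∈ Subgroup.closure {x0, x1} := Subgroup.subset_closure (Or.inr rfl)
      exact mul_mem (mul_mem (zpow_mem h0 N) h1) (inv_mem (zpow_mem h0 N))
    have hlow : ∀ t : ℝ, t ≤ N → τ t = t := fun t ht => by
      rw [hτ, conj_x1_apply, x1_of_le_zero (by linarith)]
      ring
    have hhigh : ∀ t : ℝ, N + 1 ≤ t → τ t = t + 1 := fun t ht => by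
      rw [hτ, conj_x1_apply, x1_of_one_le (by linarith)]
      ring
    have hsub : {x : ℝ | (∃ n : ℤ, (φ * τ) n = x) ∧ ∀ k : ℤ, x ≠ k} ⊆
        {x : ℝ | (∃ n : ℤ, φ n = x) ∧ ∀ k : ℤ, x ≠ k} \ {φ (N + 1)} := by
      rintro _ ⟨⟨n, rfl⟩, hx⟩
      rw [RelIso.mul_apply] at hx ⊢
      rcases le_or_gt n N with hn | hn
      · have hn' : (n : ℝ) ≤ N := by exact_mod_cast hn
        rw [hlow n hn'] at hx ⊢
        refine ⟨⟨⟨n, rfl⟩, hx⟩, fun hs => ?_⟩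
        have := φ.injective hs
        linarith
      · have hn' : (N : ℝ) + 1 ≤ n := by exact_mod_cast hn
        rw [hhigh n hn'] at hx ⊢
        refine ⟨⟨⟨n + 1, by push_cast; rfl⟩, hx⟩, fun hs => ?_⟩
        have := φ.injective hs
        linarith
    have hlt : {x : ℝ | (∃ n : ℤ, (φ * τ) n = x) ∧ ∀ k : ℤ, x ≠ k}.ncard < c := by
      rw [← hc]
      refine (ncard_le_ncard hsub (h.finite.subset sdiff_subset)).trans_lt ?_
      exact ncard_sdiff_singleton_lt_of_mem ⟨⟨N + 1, by push_cast; rfl⟩, hN⟩ h.finite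
    have hφτ : IsDyadicSubdivision (φ * τ) := by
      refine ⟨fun n => ?_, h.finite.subset (hsub.trans sdiff_subset)⟩
      rcases lt_trichotomy n N with hn | rfl | hn
      · obtain ⟨i, m, e'⟩ := h.affine n
        refine ⟨i, m, fun t ht => ?_⟩
        have hn' : (n : ℝ) + 1 ≤ N := by exact_mod_cast hn
        rw [RelIso.mul_apply, hlow _ (by linarith [ht.2]), e' t ht]
      · refine ⟨j, q, fun t ht => ?_⟩
        rw [RelIso.mul_apply, hτ, conj_x1_apply, add_sub_cancel_left, x1_of_mem ht.1 ht.2,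
          add_comm, e _ ⟨by linarith [ht.1], by linarith [ht.2]⟩, pow_succ]
        field_simp
      · obtain ⟨i, m, e'⟩ := h.affine (n + 1)
        refine ⟨i, m, fun t ht => ?_⟩
        have hn' : (N : ℝ) + 1 ≤ n := by exact_mod_cast hn
        rw [RelIso.mul_apply, hhigh _ (by linarith [ht.1]), ← e' t ht]
        push_cast
        ring_nf
    have := mul_mem (ih _ hlt hφτ rfl) (inv_mem hτmem)
    rwa [mul_inv_cancel_right] at this

/-- All intervals `[n / 2 ^ N, (n + 1) / 2 ^ N]` in `[a, b]` are mapped affinely to standard dyadic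
intervals. -/
def SubdividesAt (f : ℝ ≃o ℝ) (a b : ℝ) (N : ℕ) : Prop :=
  ∀ n : ℤ, a ≤ n / 2 ^ N → (n + 1) / 2 ^ N ≤ b →
    ∃ (i : ℕ) (m : ℤ), ∀ t ∈ Icc (0 : ℝ) 1, f ((n + t) / 2 ^ N) = (m + t) / 2 ^ i

/-- An interval of length `2 ^ (-N)` is mapped to one of length `2 ^ (e - N)`. The image is standard
as soon as the dyadic offset `c` is a multiple of that length. -/
theorem eventually_subdividesAt_of_affine {f : ℝ ≃o ℝ} {a b : ℝ} {e : ℤ} {c : ℝ}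
    (hf : ∀ y ∈ Icc a b, f y = 2 ^ e * y + c) (hc : IsDyadic c) :
    ∀ᶠ N in atTop, SubdividesAt f a b N := by
  obtain ⟨p, q, rfl⟩ := hc
  filter_upwards [eventually_ge_atTop (e + q).toNat, eventually_ge_atTop q] with N h1 h2
  intro n ha hb
  obtain ⟨i, hi⟩ : ∃ i : ℕ, (N : ℤ) - e = i + q := ⟨(N - e - q).toNat, by omega⟩
  have hN : (2 : ℝ) ^ N = 2 ^ e * (2 ^ i * 2 ^ q) := by
    rw [← zpow_natCast, ← zpow_natCast, ← zpow_natCast, ← zpow_add₀ (by norm_num),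
      ← zpow_add₀ (by norm_num)]
    congr 1
    omega
  refine ⟨i + q, n + p * 2 ^ i, fun t ht => ?_⟩
  have hpos : (0 : ℝ) < 2 ^ N := by positivity
  rw [hf _ ⟨ha.trans ?_, le_trans ?_ hb⟩]
  · rw [hN, pow_add]
    push_cast
    field_simp
    ring
  · gcongr
    linarith [ht.1]
  · gcongr
    exact ht.2

theorem SubdividesAt.union {f : ℝ ≃o ℝ} {a b c : ℝ} {N : ℕ} (h : SubdividesAt f a b N)
    (h' : SubdividesAt f b c N) {m : ℤ} (hb : 2 ^ N * b = m) : SubdividesAt f a c N := by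
  intro n ha hc
  have hb' : b = m / 2 ^ N := by rw [← hb]; field_simp
  rcases lt_or_ge n m with hn | hn
  · refine h n ha ?_
    rw [hb']
    gcongr
    exact_mod_cast hn
  · refine h' n ?_ hc
    rw [hb']
    gcongr

/-- At a level `J` that contains all breakpoints in `[0, M]`, each cell carries one affine piece.
Its offset is dyadic because `f` preserves dyadic numbers, and the finitely many cells are joined
one at a time. -/
theorem eventually_subdividesAt {f : ℝ ≃o ℝ} (hf : f ∈ PL2) (M : ℕ) :
    ∀ᶠ N in atTop, SubdividesAt f 0 M N := by
  obtain ⟨⟨B, hB, hB', haff⟩, hd⟩ := hf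
  obtain ⟨J, hJ⟩ := exists_common_level (hB' 0 M) fun s hs => hB s hs.1
  have key : ∀ k : ℕ, k ≤ 2 ^ J * M → ∀ᶠ N in atTop, SubdividesAt f 0 (k / 2 ^ J) N := by
    intro k
    induction k with
    | zero =>
      refine fun _ => Eventually.of_forall fun N n h0 h1 => absurd h0 (not_le.2 ?_)
      rw [Nat.cast_zero, zero_div] at h1
      refine lt_of_lt_of_le ?_ h1
      gcongr
      linarith
    | succ k ih =>
      intro hk
      have hk' : ((k : ℝ) + 1) / 2 ^ J ≤ M := by
        rw [div_le_iff₀' (by positivity)]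
        exact_mod_cast hk
      have hlt : (k : ℝ) / 2 ^ J < (k + 1) / 2 ^ J := by
        gcongr
        linarith
      have h0 : (0 : ℝ) ≤ k / 2 ^ J := by positivity
      have hdis : Disjoint B (Ioo ((k : ℝ) / 2 ^ J) ((k + 1) / 2 ^ J)) := by
        rw [Set.disjoint_left]
        rintro s hs ⟨h1, h2⟩
        obtain ⟨m, hm⟩ := hJ s ⟨hs, by linarith, by linarith⟩
        rw [div_lt_iff₀' (by positivity), hm] at h1
        rw [lt_div_iff₀' (by positivity), hm] at h2
        have h1' : (k : ℤ) < m := by exact_mod_cast h1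
        have h2' : m < (k : ℤ) + 1 := by exact_mod_cast h2
        omega
      obtain ⟨e, c, hec⟩ := haff _ _ hlt hdis
      have hc : IsDyadic c := by
        have h1 := hec _ (left_mem_Icc.2 hlt.le)
        have h2 : IsDyadic ((k : ℝ) / 2 ^ J) := ⟨k, J, by push_cast; rfl⟩
        have h3 : c = f (k / 2 ^ J) - 2 ^ e * (k / 2 ^ J) := by
          simp only [id] at h1
          rw [h1]
          ring
        rw [h3]
        exact ((hd _).2 h2).sub (h2.zpow_mul e)
      push_cast
      filter_upwards [ih (by omega), eventually_subdividesAt_of_affine hec hc,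
        eventually_ge_atTop J] with N h1 h2 h3
      obtain ⟨d, rfl⟩ : ∃ d, N = J + d := ⟨N - J, by omega⟩
      exact h1.union h2 (m := 2 ^ d * k) (by rw [pow_add]; push_cast; field_simp)
  have := key (2 ^ J * M) le_rfl
  push_cast at this
  rwa [mul_div_cancel_left₀ _ (by positivity)] at this

/-- The map which is the identity for `t ≤ 0`, maps `[0, 2 ^ N * M]` affinely to `[0, M]`, and is
a translation afterwards. -/
noncomputable def uniformFun (N M : ℕ) (t : ℝ) : ℝ :=
  if t ≤ 0 then t else if t ≤ 2 ^ N * M then t / 2 ^ N else t - 2 ^ N * M + M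

theorem uniformFun_strictMono (N M : ℕ) : StrictMono (uniformFun N M) := by
  intro s t h
  have hp : (0 : ℝ) < 2 ^ N := by positivity
  have h1 : s / 2 ^ N < t / 2 ^ N := by gcongr
  have h2 : 2 ^ N * (M : ℝ) / 2 ^ N = M := by field_simp
  unfold uniformFun
  split_ifs with a b c d e g
  · exact h
  · exact a.trans_lt (div_pos (not_le.1 b) hp)
  · have : (0 : ℝ) ≤ M := by positivity
    linarith
  · linarith
  · exact h1
  · have : s / 2 ^ N ≤ 2 ^ N * (M : ℝ) / 2 ^ N := by gcongr
    linarith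
  · linarith
  · linarith
  · linarith

/-- The uniform subdivision of the interval `[0, M]`, as a homeomorphism. -/
noncomputable def uniform (N M : ℕ) : ℝ ≃o ℝ :=
  (uniformFun_strictMono N M).orderIsoOfRightInverse (uniformFun N M)
    (fun t => if t ≤ 0 then t else if t ≤ M then 2 ^ N * t else t - M + 2 ^ N * M)
    (fun t => by
      have hp : (0 : ℝ) < 2 ^ N := by positivity
      have hM : (0 : ℝ) ≤ 2 ^ N * M := by positivity
      have hM' : (0 : ℝ) ≤ M := by positivity
      dsimp only
      by_cases h0 : t ≤ 0
      · rw [if_pos h0, uniformFun, if_pos h0]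
      by_cases h1 : t ≤ M
      · rw [if_neg h0, if_pos h1, uniformFun, if_neg (not_le.2 (mul_pos hp (not_le.1 h0))),
          if_pos (by gcongr)]
        field_simp
      · rw [if_neg h0, if_neg h1, uniformFun, if_neg (by linarith), if_neg (by linarith)]
        ring)

theorem uniform_of_le_zero (N M : ℕ) {t : ℝ} (h : t ≤ 0) : uniform N M t = t := if_pos h

theorem uniform_of_mem {N M : ℕ} {t : ℝ} (h : 0 ≤ t) (h' : t ≤ 2 ^ N * M) :
    uniform N M t = t / 2 ^ N := by
  change uniformFun N M t = _
  unfold uniformFun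
  rw [if_pos h']
  split_ifs with h0
  · rw [le_antisymm h0 h, zero_div]
  · rfl

theorem uniform_of_le {N M : ℕ} {t : ℝ} (h : 2 ^ N * M ≤ t) :
    uniform N M t = t - 2 ^ N * M + M := by
  rcases h.eq_or_lt with rfl | h
  · rw [uniform_of_mem (by positivity) le_rfl]
    field_simp
    ring
  · have h0 : (0 : ℝ) ≤ 2 ^ N * M := by positivity
    change uniformFun N M t = _
    unfold uniformFun
    rw [if_neg (by linarith), if_neg (by linarith)]

/-- `uniform N M` carries the unit intervals of `[0, 2 ^ N * M]` to the cells of level `N` in `[0,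
M]`, and `f` carries these to standard intervals. Outside, the composite is an integral translation
on each side. -/
theorem SubdividesAt.isDyadicSubdivision {f : ℝ ≃o ℝ} {M N : ℕ} (h : SubdividesAt f 0 M N)
    {k l : ℤ} (hl : ∀ x ≤ 0, f x = x + l) (hk : ∀ x : ℝ, M ≤ x → f x = x + k) :
    IsDyadicSubdivision (f * uniform N M) := by
  have hlow : ∀ t : ℝ, t ≤ 0 → (f * uniform N M) t = t + l := fun t ht => by
    rw [RelIso.mul_apply, uniform_of_le_zero N M ht, hl t ht]
  have hhigh : ∀ t : ℝ, 2 ^ N * M ≤ t → (f * uniform N M) t = t - 2 ^ N * M + M + k :=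
    fun t ht => by rw [RelIso.mul_apply, uniform_of_le ht, hk _ (by linarith)]
  have hp : (0 : ℝ) < 2 ^ N := by positivity
  constructor
  · intro n
    rcases lt_or_ge n 0 with h0 | h0
    · refine ⟨0, n + l, fun t ht => ?_⟩
      have h0' : (n : ℝ) + 1 ≤ 0 := by exact_mod_cast h0
      rw [hlow _ (by linarith [ht.2])]
      push_cast
      ring
    have h0' : (0 : ℝ) ≤ n := by exact_mod_cast h0
    rcases lt_or_ge n (2 ^ N * M) with h1 | h1
    · have h1' : (n : ℝ) + 1 ≤ 2 ^ N * M := by exact_mod_cast h1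
      obtain ⟨i, m, e⟩ := h n (by positivity) (by rwa [div_le_iff₀' hp])
      refine ⟨i, m, fun t ht => ?_⟩
      rw [RelIso.mul_apply, uniform_of_mem (by linarith [ht.1]) (by linarith [ht.2]), e t ht]
    · have h1' : (2 : ℝ) ^ N * M ≤ n := by exact_mod_cast h1
      refine ⟨0, n - 2 ^ N * M + M + k, fun t ht => ?_⟩
      rw [hhigh _ (by linarith [ht.1])]
      push_cast
      ring
  · refine ((finite_Icc (0 : ℤ) (2 ^ N * M)).image fun n : ℤ => (f * uniform N M) n).subset ?_
    rintro _ ⟨⟨n, rfl⟩, hx⟩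
    refine ⟨n, ⟨?_, ?_⟩, rfl⟩
    · by_contra h0
      have h0' : (n : ℝ) ≤ 0 := by exact_mod_cast (not_le.1 h0).le
      exact hx (n + l) (by rw [hlow _ h0']; push_cast; ring)
    · by_contra h0
      have h0' : (2 : ℝ) ^ N * M ≤ n := by exact_mod_cast (not_le.1 h0).le
      exact hx (n - 2 ^ N * M + M + k) (by rw [hhigh _ h0']; push_cast; ring)

/-- After a shift by `M`, `f` is an integral translation on each side of `[0, 2 * M]`. With `u` the
uniform subdivision, both `f * u` and `u` are dyadic subdivisions, so `f = (f * u) * u⁻¹` is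
generated by `x0` and `x1`. -/
theorem closure_x0_x1 : Subgroup.closure {x0, x1} = Fx := by
  apply le_antisymm
  · rw [Subgroup.closure_le]
    rintro _ (rfl | rfl)
    · exact x0_mem_Fx
    · exact x1_mem_Fx
  · rintro f ⟨hf, ⟨k, hk⟩, ⟨l, hl⟩⟩
    obtain ⟨K, hK⟩ := eventually_atTop.1 hk
    obtain ⟨L, hL⟩ := eventually_atBot.1 hl
    obtain ⟨M, hM⟩ := exists_nat_ge (max K (-L))
    have hMK : K ≤ M := (le_max_left _ _).trans hM
    have hML : -L ≤ M := (le_max_right _ _).trans hM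
    have h0 : x0 ^ M ∈ Subgroup.closure {x0, x1} :=
      pow_mem (Subgroup.subset_closure (mem_insert _ _)) M
    have hf' : f * (x0 ^ M)⁻¹ ∈ PL2 := mul_mem hf (inv_mem (pow_mem x0_mem_PL2 M))
    -- The identity is included so that one level `N` makes `uniform N (2 * M)` itself a dyadic
    -- subdivision.
    obtain ⟨N, h1, h2⟩ := ((eventually_subdividesAt hf' (2 * M)).and
      (eventually_subdividesAt PL2.one_mem (2 * M))).exists
    have h3 := h1.isDyadicSubdivision (l := l - M) (k := k - M)
      (fun x hx => by
        rw [RelIso.mul_apply, x0_pow_inv_apply, hL _ (by linarith)]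
        push_cast
        ring)
      (fun x hx => by
        push_cast at hx
        rw [RelIso.mul_apply, x0_pow_inv_apply, hK _ (by linarith)]
        push_cast
        ring)
    have h4 := h2.isDyadicSubdivision (l := 0) (k := 0) (fun x _ => by simp) (fun x _ => by simp)
    rw [one_mul] at h4
    have := mul_mem (mul_mem h3.mem_closure (inv_mem h4.mem_closure)) h0
    rwa [mul_inv_cancel_right, inv_mul_cancel_right] at this

/-! ### The conjugation `theta` between the line and the open unit interval -/

/-- The piecewise linear interpolation of `n ↦ 2 ^ (n - 1)`. -/
noncomputable def plExp (x : ℝ) : ℝ := 2 ^ (⌊x⌋ - 1) * (1 + Int.fract x)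

theorem plExp_pos (x : ℝ) : 0 < plExp x :=
  mul_pos (by positivity) (by linarith [Int.fract_nonneg x])

/-- This is the purpose of `plExp`: integral translations of the line become multiplications by
powers of `2`, which are the germs of elements of `F` at an endpoint. -/
theorem plExp_add_int (x : ℝ) (k : ℤ) : plExp (x + k) = 2 ^ k * plExp x := by
  rw [plExp, plExp, Int.floor_add_intCast, Int.fract_add_intCast, ← mul_assoc,
    ← zpow_add₀ (by norm_num)]
  congr 2
  ring

theorem plExp_eq (n : ℤ) {x : ℝ} (h : n ≤ x) (h' : x ≤ n + 1) :
    plExp x = 2 ^ (n - 1) * (1 + x - n) := by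
  rcases h'.eq_or_lt with rfl | h'
  · have h1 : plExp ((n : ℝ) + 1) = 2 ^ n * plExp 1 := by rw [add_comm, plExp_add_int]
    have h2 : plExp 1 = 1 := by simp [plExp]
    rw [h1, h2, zpow_sub_one₀ (by norm_num)]
    ring
  · have : ⌊x⌋ = n := Int.floor_eq_iff.2 ⟨h, h'⟩
    rw [plExp, Int.fract, this]
    ring

theorem plExp_strictMono : StrictMono plExp := by
  intro x y hxy
  have hx : (0 : ℝ) < 2 ^ (⌊x⌋ - 1) := by positivity
  rcases (Int.floor_le_floor hxy.le).eq_or_lt with h | h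
  · have h1 : Int.fract x < Int.fract y := by
      rw [Int.fract, Int.fract, h]
      linarith
    rw [plExp, plExp, ← h]
    gcongr
  · have h1 : plExp x < 2 ^ ⌊x⌋ := by
      rw [plExp, zpow_sub₀ (by norm_num)]
      have : (0 : ℝ) < 2 ^ ⌊x⌋ := by positivity
      have := Int.fract_lt_one x
      rw [zpow_one]
      nlinarith
    have h2 : (2 : ℝ) ^ (⌊y⌋ - 1) ≤ plExp y := by
      rw [plExp]
      exact le_mul_of_one_le_right (by positivity) (by linarith [Int.fract_nonneg y])
    have h3 : (2 : ℝ) ^ ⌊x⌋ ≤ 2 ^ (⌊y⌋ - 1) := zpow_le_zpow_right₀ (by norm_num) (by omega)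
    linarith

theorem exists_plExp_eq {y : ℝ} (hy : 0 < y) : ∃ x, plExp x = y := by
  have h1 := Int.zpow_log_le_self (b := 2) (by norm_num) hy
  have h2 := Int.lt_zpow_succ_log_self (b := 2) (by norm_num) y
  generalize Int.log 2 y = n at h1 h2
  push_cast at h1 h2
  have hp : (0 : ℝ) < 2 ^ n := by positivity
  rw [zpow_add₀ (by norm_num), zpow_one] at h2
  have h3 : 1 ≤ y / 2 ^ n := by rwa [le_div_iff₀ hp, one_mul]
  have h4 : y / 2 ^ n ≤ 2 := by rw [div_le_iff₀ hp]; linarith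
  refine ⟨n + y / 2 ^ n, ?_⟩
  rw [plExp_eq (n + 1) (by push_cast; linarith) (by push_cast; linarith), add_sub_cancel_right]
  push_cast
  field_simp
  ring

/-- The piecewise linear homeomorphism of the line onto `(0, 1)` which conjugates `g0` to `x0` and
`g1` to `x1`. -/
noncomputable def theta (x : ℝ) : ℝ := if x ≤ 0 then plExp x else 1 - plExp (-x)

theorem plExp_zero : plExp 0 = 1 / 2 := by simp [plExp]

theorem theta_of_nonpos {x : ℝ} (h : x ≤ 0) : theta x = plExp x := if_pos h

theorem theta_of_nonneg {x : ℝ} (h : 0 ≤ x) : theta x = 1 - plExp (-x) := by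
  rcases h.eq_or_lt with rfl | h
  · rw [theta_of_nonpos le_rfl, neg_zero, plExp_zero]
    norm_num
  · exact if_neg (not_le.2 h)

theorem plExp_le_half {x : ℝ} (h : x ≤ 0) : plExp x ≤ 1 / 2 :=
  plExp_zero ▸ plExp_strictMono.monotone h

theorem theta_strictMono : StrictMono theta := by
  intro x y hxy
  rcases le_total y 0 with hy | hy
  · rw [theta_of_nonpos hy, theta_of_nonpos (hxy.le.trans hy)]
    exact plExp_strictMono hxy
  · rcases le_total x 0 with hx | hx
    · rw [theta_of_nonneg hy, theta_of_nonpos hx]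
      have h1 := plExp_le_half hx
      have h2 := plExp_le_half (neg_nonpos.2 hy)
      rcases hx.eq_or_lt with rfl | hx
      · have h3 := plExp_strictMono (neg_lt_zero.2 hxy)
        rw [plExp_zero] at *
        linarith
      · have h3 := plExp_strictMono hx
        rw [plExp_zero] at h3
        linarith
    · rw [theta_of_nonneg hy, theta_of_nonneg hx]
      have := plExp_strictMono (neg_lt_neg hxy)
      linarith

theorem theta_mem_Ioo (x : ℝ) : theta x ∈ Ioo (0 : ℝ) 1 := by
  rcases le_total x 0 with hx | hx
  · rw [theta_of_nonpos hx]
    exact ⟨plExp_pos x, by linarith [plExp_le_half hx]⟩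
  · rw [theta_of_nonneg hx]
    exact ⟨by linarith [plExp_le_half (neg_nonpos.2 hx)], by linarith [plExp_pos (-x)]⟩

theorem exists_theta_eq {t : ℝ} (h0 : 0 < t) (h1 : t < 1) : ∃ x, theta x = t := by
  rcases le_total t (1 / 2) with ht | ht
  · obtain ⟨x, hx⟩ := exists_plExp_eq h0
    refine ⟨x, ?_⟩
    rw [theta_of_nonpos, hx]
    rwa [← plExp_strictMono.le_iff_le, plExp_zero, hx]
  · obtain ⟨x, hx⟩ := exists_plExp_eq (sub_pos.2 h1)
    refine ⟨-x, ?_⟩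
    rw [theta_of_nonneg, neg_neg, hx]
    · ring
    · rw [Left.nonneg_neg_iff, ← plExp_strictMono.le_iff_le, plExp_zero, hx]
      linarith

theorem theta_affine (n : ℤ) : ∃ (e : ℤ) (c : ℝ), IsDyadic c ∧
    ∀ x ∈ Icc (n : ℝ) (n + 1), theta x = 2 ^ e * x + c := by
  have one : IsDyadic 1 := by simpa using isDyadic_intCast 1
  rcases lt_or_ge n 0 with hn | hn
  · have hn' : (n : ℝ) + 1 ≤ 0 := by exact_mod_cast hn
    refine ⟨n - 1, 2 ^ (n - 1) * ((1 - n : ℤ) : ℝ), (isDyadic_intCast _).zpow_mul _,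
      fun x hx => ?_⟩
    rw [theta_of_nonpos (hx.2.trans hn'), plExp_eq n hx.1 hx.2]
    push_cast
    ring
  · have hn' : (0 : ℝ) ≤ n := by exact_mod_cast hn
    refine ⟨-n - 1 - 1, 1 - 2 ^ (-n - 1 - 1) * ((n + 2 : ℤ) : ℝ),
      one.sub ((isDyadic_intCast _).zpow_mul _), fun x hx => ?_⟩
    rw [theta_of_nonneg (hn'.trans hx.1), plExp_eq (-n - 1) (by push_cast; linarith [hx.2])
      (by push_cast; linarith [hx.1])]
    push_cast
    ring

theorem isDyadic_theta_iff (x : ℝ) : IsDyadic (theta x) ↔ IsDyadic x := by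
  obtain ⟨e, c, hc, h⟩ := theta_affine ⌊x⌋
  rw [h x ⟨Int.floor_le x, (Int.lt_floor_add_one x).le⟩]
  refine ⟨fun h => ?_, fun h => (h.zpow_mul e).add hc⟩
  rw [← isDyadic_zpow_mul_iff e]
  simpa using h.sub hc

theorem theta_add_int_of_nonpos {x : ℝ} {k : ℤ} (h : x ≤ 0) (h' : x + k ≤ 0) :
    theta (x + k) = 2 ^ k * theta x := by
  rw [theta_of_nonpos h, theta_of_nonpos h', plExp_add_int]

/-- At the right end the distance to `1` is what scales, and it decreases in `x`. Hence slope `2 ^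
k` at `1` corresponds to translation by `-k`. -/
theorem theta_sub_int_of_nonneg {x : ℝ} {k : ℤ} (h : 0 ≤ x) (h' : 0 ≤ x - k) :
    1 - theta (x - k) = 2 ^ k * (1 - theta x) := by
  rw [theta_of_nonneg h, theta_of_nonneg h', neg_sub', sub_neg_eq_add, plExp_add_int]
  ring

/-- The breakpoints `1 / 4` and `1 / 2` of `g0` are the values of `theta` at `-1` and `0`; on the
outer pieces the scaling rules apply. -/
theorem theta_add_one (x : ℝ) : theta (x + 1) = g0Fun (theta x) := by
  rcases le_total x (-1) with h | h
  · have h1 : plExp x ≤ 1 / 4 := by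
      have := plExp_strictMono.monotone h
      rw [plExp_eq (-1) (x := -1) (by simp) (by simp)] at this
      norm_num at this
      linarith
    have := theta_add_int_of_nonpos (x := x) (k := 1) (by linarith) (by push_cast; linarith)
    push_cast at this
    rw [this, g0Fun, if_pos (by rwa [theta_of_nonpos (by linarith)]), zpow_one]
  rcases le_total x 0 with h' | h'
  · rw [theta_of_nonneg (by linarith), theta_of_nonpos h',
      plExp_eq (-1) (x := -(x + 1)) (by push_cast; linarith) (by push_cast; linarith),
      plExp_eq (-1) (x := x) (by push_cast; linarith) (by push_cast; linarith), g0Fun]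
    norm_num
    split_ifs <;> linarith
  · have := theta_sub_int_of_nonneg (x := x) (k := -1) (by linarith) (by push_cast; linarith)
    push_cast at this
    rw [sub_neg_eq_add] at this
    have h2 : 1 / 2 ≤ theta x := by
      rw [theta_of_nonneg h']
      linarith [plExp_le_half (neg_nonpos.2 h')]
    rw [g0Fun, if_neg (by linarith)]
    split_ifs <;> norm_num at this <;> linarith

theorem theta_of_mem {x : ℝ} (h : 0 ≤ x) (h' : x ≤ 1) : theta x = 1 / 2 + x / 4 := by
  rw [theta_of_nonneg h, plExp_eq (-1) (by push_cast; linarith) (by push_cast; linarith)]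
  norm_num
  ring

theorem theta_x1 (x : ℝ) : theta (x1 x) = g1Fun (theta x) := by
  rcases le_total x 0 with h | h
  · rw [x1_of_le_zero h, g1Fun, if_pos]
    rw [theta_of_nonpos h]
    exact plExp_le_half h
  rcases le_total x 1 with h' | h'
  · rw [x1_of_mem h h', theta_of_mem h h', g1Fun]
    -- `theta` changes slope at `1`, which `x1` reaches at `1 / 2`; this is the breakpoint `5 / 8`
    -- of `g1`.
    rcases le_total x (1 / 2) with h2 | h2
    · rw [theta_of_mem (by linarith) (by linarith)]
      split_ifs <;> linarith
    · rw [theta_of_nonneg (by linarith),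
        plExp_eq (-2) (by push_cast; linarith) (by push_cast; linarith)]
      norm_num
      split_ifs <;> linarith
  · have h2 : 3 / 4 ≤ theta x := by
      have := theta_strictMono.monotone h'
      rw [theta_of_mem zero_le_one le_rfl] at this
      linarith
    rw [x1_of_one_le h', theta_add_one, g0Fun, g1Fun]
    split_ifs <;> linarith

/-- The map `theta`, to the unit interval. -/
noncomputable def thetaI (x : ℝ) : I := ⟨theta x, Ioo_subset_Icc_self (theta_mem_Ioo x)⟩

theorem thetaI_strictMono : StrictMono thetaI := fun _ _ h => theta_strictMono h

theorem exists_thetaI_eq (g : I ≃o I) (x : ℝ) : ∃ y, thetaI y = g (thetaI x) := by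
  have h0 : g ⊥ < g (thetaI x) := g.strictMono (theta_mem_Ioo x).1
  have h1 : g (thetaI x) < g ⊤ := g.strictMono (theta_mem_Ioo x).2
  rw [g.map_bot] at h0
  rw [g.map_top] at h1
  obtain ⟨y, hy⟩ := exists_theta_eq h0 h1
  exact ⟨y, Subtype.ext hy⟩

theorem thetaI_invFun (g : I ≃o I) (x : ℝ) :
    thetaI (Function.invFun thetaI (g (thetaI x))) = g (thetaI x) :=
  Function.invFun_eq (exists_thetaI_eq g x)

/-- Conjugation by `theta`, from the homeomorphisms of the unit interval to those of the line. -/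
noncomputable def conjTheta : (I ≃o I) →* (ℝ ≃o ℝ) where
  toFun g := StrictMono.orderIsoOfRightInverse (fun x => Function.invFun thetaI (g (thetaI x)))
    (fun x y h => by
      rw [← thetaI_strictMono.lt_iff_lt, thetaI_invFun, thetaI_invFun]
      exact g.strictMono (thetaI_strictMono h))
    (fun x => Function.invFun thetaI (g⁻¹ (thetaI x)))
    (fun x => by
      apply thetaI_strictMono.injective
      rw [thetaI_invFun, thetaI_invFun, RelIso.apply_inv_self])
  map_one' := by
    ext x
    exact thetaI_strictMono.injective (thetaI_invFun 1 x)
  map_mul' f g := by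
    ext x
    apply thetaI_strictMono.injective
    refine (thetaI_invFun (f * g) x).trans ?_
    rw [RelIso.mul_apply, ← thetaI_invFun g]
    exact (thetaI_invFun f _).symm

theorem thetaI_conjTheta (g : I ≃o I) (x : ℝ) : thetaI (conjTheta g x) = g (thetaI x) :=
  thetaI_invFun g x

theorem conjTheta_eq {g : I ≃o I} {f : ℝ ≃o ℝ} (h : ∀ x, thetaI (f x) = g (thetaI x)) :
    conjTheta g = f := by
  ext x
  apply thetaI_strictMono.injective
  rw [thetaI_conjTheta, h]

theorem conjTheta_g0 : conjTheta g0 = x0 := conjTheta_eq fun x => Subtype.ext (theta_add_one x)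

theorem conjTheta_g1 : conjTheta g1 = x1 := conjTheta_eq fun x => Subtype.ext (theta_x1 x)

theorem conjTheta_injective : Function.Injective conjTheta := by
  rw [injective_iff_map_eq_one]
  intro g hg
  refine RelIso.ext fun t => ?_
  rcases (bot_le : ⊥ ≤ t).eq_or_lt with rfl | h0
  · exact g.map_bot
  rcases (le_top : t ≤ ⊤).eq_or_lt with rfl | h1
  · exact g.map_top
  obtain ⟨x, hx⟩ := exists_theta_eq h0 h1
  obtain rfl : thetaI x = t := Subtype.ext hx
  rw [← thetaI_conjTheta, hg]
  rfl

theorem finite_range_intCast_inter_Icc (a b : ℝ) :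
    (range ((↑) : ℤ → ℝ) ∩ Icc a b).Finite := by
  refine ((finite_Icc ⌈a⌉ ⌊b⌋).image ((↑) : ℤ → ℝ)).subset ?_
  rintro _ ⟨⟨n, rfl⟩, h1, h2⟩
  exact ⟨n, ⟨Int.ceil_le.2 h1, Int.le_floor.2 h2⟩, rfl⟩

theorem le_floor_add_one_of_disjoint {a b : ℝ}
    (h : Disjoint (range ((↑) : ℤ → ℝ)) (Ioo a b)) : b ≤ ⌊a⌋ + 1 := by
  by_contra hb
  exact disjoint_left.1 h ⟨⌊a⌋ + 1, by push_cast; rfl⟩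
    ⟨Int.lt_floor_add_one a, not_le.1 hb⟩

theorem conjTheta_mem_PL2 {g : I ≃o I} (hg : g ∈ F) : conjTheta g ∈ PL2 := by
  have hd := IsDyadicPL.preservesDyadic hg
  set f := conjTheta g with hf
  have hfd : PreservesDyadic (id : ℝ → ℝ) f := fun x => by
    have h1 := isDyadic_theta_iff (f x)
    have h2 := isDyadic_theta_iff x
    have h3 : theta (f x) = g (thetaI x) := congrArg Subtype.val (thetaI_conjTheta g x)
    rw [h3] at h1
    exact h1.symm.trans ((hd (thetaI x)).trans h2)
  obtain ⟨A, hA, hA', hA''⟩ := hg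
  have hAfin : A.Finite := by
    have h := hA' ⊥ ⊤
    rwa [Icc_bot_top, inter_univ] at h
  -- The three sets account for the breaks of `theta`, of `g`, and of the inverse of `theta`.
  refine ⟨⟨range ((↑) : ℤ → ℝ) ∪ (thetaI ⁻¹' A ∪ f ⁻¹' range ((↑) : ℤ → ℝ)), ?_, ?_, ?_⟩, hfd⟩
  · rintro b (⟨n, rfl⟩ | hb | ⟨n, hn⟩)
    · exact isDyadic_intCast n
    · exact (isDyadic_theta_iff b).1 (hA _ hb)
    · refine (hfd b).1 ?_
      rw [id, ← hn]
      exact isDyadic_intCast n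
  · intro a b
    rw [union_inter_distrib_right, union_inter_distrib_right]
    refine (finite_range_intCast_inter_Icc a b).union (.union ?_ ?_)
    · exact (hAfin.preimage thetaI_strictMono.injective.injOn).inter_of_left _
    · refine ((finite_range_intCast_inter_Icc (f a) (f b)).preimage
        f.injective.injOn).subset ?_
      rintro x ⟨hx, h1, h2⟩
      exact ⟨hx, f.monotone h1, f.monotone h2⟩
  · intro a b hab hdis
    rw [disjoint_union_left, disjoint_union_left] at hdis
    obtain ⟨d1, d2, d3⟩ := hdis
    have hb := le_floor_add_one_of_disjoint d1
    have hfb : f b ≤ ⌊f a⌋ + 1 := by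
      apply le_floor_add_one_of_disjoint
      rw [disjoint_left]
      rintro y hy ⟨h1, h2⟩
      refine disjoint_left.1 d3 (show f.symm y ∈ _ by simpa using hy) ⟨?_, ?_⟩
      · exact f.lt_symm_apply.2 h1
      · exact f.symm_apply_lt.2 h2
    obtain ⟨e, c, -, h1⟩ := theta_affine ⌊a⌋
    obtain ⟨e', c', -, h2⟩ := theta_affine ⌊f a⌋
    obtain ⟨n, d, h3⟩ := hA'' (thetaI a) (thetaI b) (thetaI_strictMono hab) (by
      rw [disjoint_left]
      rintro t ht ⟨h1, h2⟩
      obtain ⟨x, hx⟩ := exists_theta_eq ((theta_mem_Ioo a).1.trans h1)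
        (lt_trans h2 (theta_mem_Ioo b).2)
      obtain rfl : thetaI x = t := Subtype.ext hx
      exact disjoint_left.1 d2 ht
        ⟨thetaI_strictMono.lt_iff_lt.1 h1, thetaI_strictMono.lt_iff_lt.1 h2⟩)
    -- Obtained by solving `2 ^ e' * f y + c' = 2 ^ n * (2 ^ e * y + c) + d` for `f y`.
    refine ⟨n + e - e', 2 ^ (-e') * (2 ^ n * c + d - c'), fun y hy => ?_⟩
    have i1 := h1 y ⟨(Int.floor_le a).trans hy.1, hy.2.trans hb⟩
    have i2 := h2 (f y) ⟨(Int.floor_le _).trans (f.monotone hy.1), (f.monotone hy.2).trans hfb⟩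
    have i3 := h3 (thetaI y) ⟨thetaI_strictMono.monotone hy.1, thetaI_strictMono.monotone hy.2⟩
    have i4 : theta (f y) = g (thetaI y) := congrArg Subtype.val (thetaI_conjTheta g y)
    have i5 : ((thetaI y : I) : ℝ) = theta y := rfl
    rw [i5, i1, ← i4, i2] at i3
    have hp : (2 : ℝ) ^ e' ≠ 0 := by positivity
    rw [zpow_sub₀ (by norm_num), zpow_add₀ (by norm_num), zpow_neg]
    simp only [id]
    field_simp
    linarith

theorem exists_lt_top_disjoint {A : Set I} (hA : A.Finite) : ∃ a < ⊤, Disjoint A (Ioo a ⊤) := by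
  obtain ⟨a, ha, hmax⟩ := exists_max_image (insert ⊥ (A ∩ Iio ⊤)) id
    ((hA.inter_of_left _).insert _) (insert_nonempty _ _)
  refine ⟨a, ?_, ?_⟩
  · rcases ha with rfl | ha
    · exact bot_lt_top
    · exact ha.2
  · rw [disjoint_left]
    rintro t ht ⟨h1, h2⟩
    exact (hmax t (Or.inr ⟨ht, h2⟩)).not_gt h1

theorem exists_bot_lt_disjoint {A : Set I} (hA : A.Finite) : ∃ a > ⊥, Disjoint A (Ioo ⊥ a) := by
  obtain ⟨a, ha, hmin⟩ := exists_min_image (insert ⊤ (A ∩ Ioi ⊥)) id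
    ((hA.inter_of_left _).insert _) (insert_nonempty _ _)
  refine ⟨a, ?_, ?_⟩
  · rcases ha with rfl | ha
    · exact bot_lt_top
    · exact ha.2
  · rw [disjoint_left]
    rintro t ht ⟨h1, h2⟩
    exact (hmin t (Or.inr ⟨ht, h1⟩)).not_gt h2

/-- Near an endpoint `g` is affine and fixes that endpoint, so it scales the distance to it by some
`2 ^ n`. `theta` turns this scaling into translation by `n` at `-∞` and by `-n` at `+∞`. -/
theorem conjTheta_mem_Fx {g : I ≃o I} (hg : g ∈ F) : conjTheta g ∈ Fx := by
  refine ⟨conjTheta_mem_PL2 hg, ?_⟩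
  set f := conjTheta g with hf
  have hfg : ∀ x, theta (f x) = g (thetaI x) := fun x => congrArg Subtype.val (thetaI_conjTheta g x)
  obtain ⟨A, hA, hA', hA''⟩ := hg
  have hAfin : A.Finite := by
    have h := hA' ⊥ ⊤
    rwa [Icc_bot_top, inter_univ] at h
  constructor
  · obtain ⟨a, ha, hdis⟩ := exists_lt_top_disjoint hAfin
    obtain ⟨n, c, h⟩ := hA'' a ⊤ ha hdis
    have ha' : (a : ℝ) < 1 := ha
    have ha0 : (0 : ℝ) ≤ a := a.2.1
    -- The point `a` may be `0`, which is not a value of `theta`; the midpoint of `a` and `1` is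
    -- one.
    obtain ⟨x₀, hx₀⟩ := exists_theta_eq (t := (a + 1) / 2) (by linarith) (by linarith)
    refine ⟨-n, ?_⟩
    filter_upwards [eventually_ge_atTop x₀, eventually_ge_atTop 0,
      eventually_ge_atTop (n : ℝ)] with x h1 h2 h3
    have i1 := h (thetaI x) ⟨Subtype.coe_le_coe.1 ?_, le_top⟩
    · have i2 := h ⊤ ⟨le_top, le_rfl⟩
      rw [g.map_top] at i2
      have i3 : ((⊤ : I) : ℝ) = 1 := rfl
      have i4 : ((thetaI x : I) : ℝ) = theta x := rfl
      have i5 := theta_sub_int_of_nonneg (k := n) h2 (by linarith)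
      rw [i3] at i2
      rw [← hfg, i4] at i1
      apply theta_strictMono.injective
      push_cast
      rw [← sub_eq_add_neg]
      linarith
    · have := theta_strictMono.monotone h1
      change (a : ℝ) ≤ theta x
      linarith
  · obtain ⟨a, ha, hdis⟩ := exists_bot_lt_disjoint hAfin
    obtain ⟨n, c, h⟩ := hA'' ⊥ a ha hdis
    have ha' : (0 : ℝ) < a := ha
    have ha1 : (a : ℝ) ≤ 1 := a.2.2
    obtain ⟨x₀, hx₀⟩ := exists_theta_eq (t := a / 2) (by linarith) (by linarith)
    refine ⟨n, ?_⟩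
    filter_upwards [eventually_le_atBot x₀, eventually_le_atBot 0,
      eventually_le_atBot (-n : ℝ)] with x h1 h2 h3
    have i1 := h (thetaI x) ⟨bot_le, Subtype.coe_le_coe.1 ?_⟩
    · have i2 := h ⊥ ⟨le_rfl, bot_le⟩
      rw [g.map_bot] at i2
      have i3 : ((⊥ : I) : ℝ) = 0 := rfl
      have i4 : ((thetaI x : I) : ℝ) = theta x := rfl
      have i5 := theta_add_int_of_nonpos (k := n) h2 (by linarith)
      rw [i3] at i2
      rw [← hfg, i4] at i1
      apply theta_strictMono.injective
      linarith
    · have := theta_strictMono.monotone h1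
      change theta x ≤ (a : ℝ)
      linarith

/-! ### The standard generators of `F` -/

theorem g0_mem_F : g0 ∈ F := by
  have q : IsDyadic (1 / 4) := ⟨1, 2, by norm_num⟩
  have q' : IsDyadic (1 / 2) := ⟨1, 1, by norm_num⟩
  refine ⟨{t : I | (t : ℝ) = 1 / 4} ∪ {t : I | (t : ℝ) = 1 / 2}, ?_, fun a b => ?_,
    fun a b hab h => ?_⟩
  · rintro b (hb | hb) <;> rw [mem_ofPred_eq] at hb <;> rwa [hb]
  · refine Finite.inter_of_left (.union ?_ ?_) _ <;>
      exact (finite_singleton _).preimage Subtype.val_injective.injOn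
  · have h1 : ¬((a : ℝ) < 1 / 4 ∧ (1 / 4 : ℝ) < b) := fun h' =>
      disjoint_left.1 h (show (⟨1 / 4, by norm_num, by norm_num⟩ : I) ∈ _ from Or.inl rfl) h'
    have h2 : ¬((a : ℝ) < 1 / 2 ∧ (1 / 2 : ℝ) < b) := fun h' =>
      disjoint_left.1 h (show (⟨1 / 2, by norm_num, by norm_num⟩ : I) ∈ _ from Or.inr rfl) h'
    rw [not_and_or, not_lt, not_lt] at h1 h2
    have hg : ∀ y, (g0 y : ℝ) = g0Fun y := fun y => rfl
    have hle : ∀ y ∈ Icc a b, (a : ℝ) ≤ y ∧ (y : ℝ) ≤ b := fun y hy => hy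
    rcases h2 with h2 | h2
    · refine ⟨-1, 1 / 2, fun y hy => ?_⟩
      obtain ⟨i1, i2⟩ := hle y hy
      rw [hg, g0Fun, zpow_neg_one]
      split_ifs <;> linarith
    rcases h1 with h1 | h1
    · refine ⟨0, 1 / 4, fun y hy => ?_⟩
      obtain ⟨i1, i2⟩ := hle y hy
      rw [hg, g0Fun, zpow_zero]
      split_ifs <;> linarith
    · refine ⟨1, 0, fun y hy => ?_⟩
      obtain ⟨i1, i2⟩ := hle y hy
      rw [hg, g0Fun, zpow_one]
      split_ifs <;> linarith

theorem g1_mem_F : g1 ∈ F := by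
  have q1 : IsDyadic (1 / 2) := ⟨1, 1, by norm_num⟩
  have q2 : IsDyadic (5 / 8) := ⟨5, 3, by norm_num⟩
  have q3 : IsDyadic (3 / 4) := ⟨3, 2, by norm_num⟩
  refine ⟨{t : I | (t : ℝ) = 1 / 2} ∪ ({t : I | (t : ℝ) = 5 / 8} ∪ {t : I | (t : ℝ) = 3 / 4}),
    ?_, fun a b => ?_, fun a b hab h => ?_⟩
  · rintro b (hb | hb | hb) <;> rw [mem_ofPred_eq] at hb <;> rwa [hb]
  · refine Finite.inter_of_left (.union ?_ (.union ?_ ?_)) _ <;>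
      exact (finite_singleton _).preimage Subtype.val_injective.injOn
  · have h1 : ¬((a : ℝ) < 1 / 2 ∧ (1 / 2 : ℝ) < b) := fun h' =>
      disjoint_left.1 h (show (⟨1 / 2, by norm_num, by norm_num⟩ : I) ∈ _ from Or.inl rfl) h'
    have h2 : ¬((a : ℝ) < 5 / 8 ∧ (5 / 8 : ℝ) < b) := fun h' =>
      disjoint_left.1 h (show (⟨5 / 8, by norm_num, by norm_num⟩ : I) ∈ _ from
        Or.inr (Or.inl rfl)) h'
    have h3 : ¬((a : ℝ) < 3 / 4 ∧ (3 / 4 : ℝ) < b) := fun h' =>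
      disjoint_left.1 h (show (⟨3 / 4, by norm_num, by norm_num⟩ : I) ∈ _ from
        Or.inr (Or.inr rfl)) h'
    rw [not_and_or, not_lt, not_lt] at h1 h2 h3
    have hg : ∀ y, (g1 y : ℝ) = g1Fun y := fun y => rfl
    have hle : ∀ y ∈ Icc a b, (a : ℝ) ≤ y ∧ (y : ℝ) ≤ b := fun y hy => hy
    rcases h3 with h3 | h3
    · refine ⟨-1, 1 / 2, fun y hy => ?_⟩
      obtain ⟨i1, i2⟩ := hle y hy
      rw [hg, g1Fun, zpow_neg_one]
      split_ifs <;> linarith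
    rcases h2 with h2 | h2
    · refine ⟨0, 1 / 8, fun y hy => ?_⟩
      obtain ⟨i1, i2⟩ := hle y hy
      rw [hg, g1Fun, zpow_zero]
      split_ifs <;> linarith
    rcases h1 with h1 | h1
    · refine ⟨1, -1 / 2, fun y hy => ?_⟩
      obtain ⟨i1, i2⟩ := hle y hy
      rw [hg, g1Fun, zpow_one]
      split_ifs <;> linarith
    · refine ⟨0, 0, fun y hy => ?_⟩
      obtain ⟨i1, i2⟩ := hle y hy
      rw [hg, g1Fun, zpow_zero]
      split_ifs <;> linarith

/-- The injective map `conjTheta` sends `F` into `Fx` and `g0, g1` to generators of `Fx`, so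
generation pulls back. That `conjTheta` maps `F` onto `Fx` is not needed. -/
theorem closure_g0_g1 : Subgroup.closure {g0, g1} = F := by
  apply le_antisymm
  · rw [Subgroup.closure_le]
    rintro _ (rfl | rfl)
    · exact g0_mem_F
    · exact g1_mem_F
  · intro g hg
    have h := conjTheta_mem_Fx hg
    rw [← closure_x0_x1, ← conjTheta_g0, ← conjTheta_g1, ← image_pair,
      ← MonoidHom.map_closure] at h
    obtain ⟨g', hg', e⟩ := h
    rwa [← conjTheta_injective e]

theorem closure_w0_w1 : Subgroup.closure {w0, w1} = Fw := by
  rw [Fw, ← closure_g0_g1, MonoidHom.map_closure, image_pair]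
  rfl

/-! ### Periodic extensions -/

theorem lift_injective : Function.Injective lift := by
  rw [injective_iff_map_eq_one]
  intro g hg
  refine RelIso.ext fun t => ?_
  rcases (le_top : t ≤ ⊤).eq_or_lt with rfl | h1
  · exact g.map_top
  have h := congrArg (fun f : ℝ ≃o ℝ => f t) hg
  have h0 : ⌊(t : ℝ)⌋ = 0 := Int.floor_eq_zero_iff.2 ⟨t.2.1, h1⟩
  have h2 : fractI t = t := Subtype.ext (Int.fract_eq_self.2 ⟨t.2.1, h1⟩)
  simp only [lift_apply, liftFun, h0, h2, RelIso.one_apply, Int.cast_zero, zero_add] at h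
  exact Subtype.ext h

theorem lift_mem_PL2 {g : I ≃o I} (hg : g ∈ F) : lift g ∈ PL2 := by
  have hd := IsDyadicPL.preservesDyadic hg
  have hfr : ∀ x : ℝ, IsDyadic (fractI x : ℝ) ↔ IsDyadic x := fun x => by
    have := isDyadic_add_int_iff (x := (fractI x : ℝ)) ⌊x⌋
    rwa [show (fractI x : ℝ) + ⌊x⌋ = x from Int.fract_add_floor x, Iff.comm] at this
  obtain ⟨A, hA, hA', hA''⟩ := hg
  have hAfin : A.Finite := by
    have h := hA' ⊥ ⊤
    rwa [Icc_bot_top, inter_univ] at h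
  refine ⟨⟨range ((↑) : ℤ → ℝ) ∪ fractI ⁻¹' A, ?_, fun a b => ?_, fun a b hab hdis => ?_⟩,
    fun x => ?_⟩
  · rintro b (⟨n, rfl⟩ | hb)
    · exact isDyadic_intCast n
    · exact (hfr b).1 (hA _ hb)
  · rw [union_inter_distrib_right]
    refine (finite_range_intCast_inter_Icc a b).union ?_
    refine ((hAfin.prod (finite_Icc ⌊a⌋ ⌊b⌋)).image
      fun p : I × ℤ => (p.2 : ℝ) + (p.1 : ℝ)).subset ?_
    rintro x ⟨hx, h1, h2⟩
    exact ⟨(fractI x, ⌊x⌋), ⟨hx, Int.floor_le_floor h1, Int.floor_le_floor h2⟩,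
      Int.floor_add_fract x⟩
  · rw [disjoint_union_left] at hdis
    obtain ⟨d1, d2⟩ := hdis
    have hb := le_floor_add_one_of_disjoint d1
    set n := ⌊a⌋ with hn
    have ha : (n : ℝ) ≤ a := Int.floor_le a
    have ha1 : a < n + 1 := Int.lt_floor_add_one a
    have hfl : ∀ y : ℝ, a ≤ y → y < n + 1 → ⌊y⌋ = n := fun y h1 h2 =>
      Int.floor_eq_iff.2 ⟨ha.trans h1, h2⟩
    -- The formula persists at the right end `n + 1`, where the fractional part jumps, because `g`
    -- fixes both endpoints.
    have key : ∀ (y : ℝ) (h : y - n ∈ Icc (0 : ℝ) 1), liftFun g y = n + (g ⟨y - n, h⟩ : ℝ) := by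
      intro y h
      rcases h.2.eq_or_lt with h1 | h1
      · have e1 : (⟨y - n, h⟩ : I) = ⊤ := Subtype.ext h1
        obtain rfl : y = ((n + 1 : ℤ) : ℝ) := by push_cast; linarith
        have e2 : fractI ((n + 1 : ℤ) : ℝ) = ⊥ := Subtype.ext (Int.fract_intCast _)
        rw [e1, g.map_top, liftFun, e2, g.map_bot, Int.floor_intCast]
        change ((n + 1 : ℤ) : ℝ) + 0 = n + 1
        push_cast
        ring
      · have e1 : ⌊y⌋ = n := Int.floor_eq_iff.2 ⟨by linarith [h.1], by linarith⟩
        have e2 : fractI y = ⟨y - n, h⟩ := Subtype.ext (show y - ⌊y⌋ = y - n by rw [e1])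
        rw [liftFun, e1, e2]
    have hmem : ∀ y ∈ Icc a b, y - n ∈ Icc (0 : ℝ) 1 := fun y hy =>
      ⟨by linarith [hy.1], by linarith [hy.2]⟩
    obtain ⟨e, c, h⟩ := hA'' ⟨a - n, hmem a (left_mem_Icc.2 hab.le)⟩
      ⟨b - n, hmem b (right_mem_Icc.2 hab.le)⟩ (Subtype.mk_lt_mk.2 (by linarith)) (by
        rw [disjoint_left]
        rintro ⟨t, ht⟩ htA ⟨h1, h2⟩
        have h1' : a - n < t := h1
        have h2' : t < b - n := h2
        have e1 : ⌊t + n⌋ = n := hfl _ (by linarith) (by linarith)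
        have e2 : fractI (t + n) = ⟨t, ht⟩ := by
          apply Subtype.ext
          change t + n - ⌊t + n⌋ = t
          rw [e1]
          ring
        refine disjoint_left.1 d2 (show t + n ∈ _ from ?_) ⟨by linarith, by linarith⟩
        rwa [mem_preimage, e2])
    refine ⟨e, c + n - 2 ^ e * n, fun y hy => ?_⟩
    have h1 := h ⟨y - n, hmem y hy⟩ ⟨Subtype.mk_le_mk.2 (by linarith [hy.1]),
      Subtype.mk_le_mk.2 (by linarith [hy.2])⟩
    simp only [id]
    rw [lift_apply, key y (hmem y hy), h1]
    ring
  · simp only [id]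
    rw [← hfr (lift g x), ← hfr x, lift_apply, fractI_liftFun]
    exact hd (fractI x)

/-! ### The semidirect decomposition of `C` -/

theorem lift_add_int (g : I ≃o I) (x : ℝ) (n : ℤ) : lift g (x + n) = lift g x + n :=
  liftFun_add_int g x n

theorem lift_add_one (g : I ≃o I) (x : ℝ) : lift g (x + 1) = lift g x + 1 := by
  simpa using lift_add_int g x 1

theorem Fw_le_C : Fw ≤ C := by
  rintro _ ⟨g, hg, rfl⟩
  exact ⟨⟨lift_mem_PL2 hg, .of_forall (lift_add_one g), .of_forall (lift_add_one g)⟩, g, hg,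
    .of_forall fun _ => rfl, .of_forall fun _ => rfl⟩

theorem Fx_le_C : Fx ≤ C := by
  rintro f ⟨hf, ⟨k, hk⟩, ⟨l, hl⟩⟩
  refine ⟨⟨hf, ?_, ?_⟩, 1, one_mem _, ?_, ?_⟩
  · filter_upwards [hk, (tendsto_atTop_add_const_right _ 1 tendsto_id).eventually hk] with x h1 h2
    simp only [id] at h2
    rw [h1, h2]
    ring
  · filter_upwards [hl, (tendsto_atBot_add_const_right _ 1 tendsto_id).eventually hl] with x h1 h2
    simp only [id] at h2
    rw [h1, h2]
    ring
  · filter_upwards [hk] with x h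
    rw [h, map_one]
    exact circle_eq_iff.2 ⟨k, rfl⟩
  · filter_upwards [hl] with x h
    rw [h, map_one]
    exact circle_eq_iff.2 ⟨l, rfl⟩

theorem eventually_add_int {f : ℝ ≃o ℝ} {l : Filter ℝ} (hl : ∀ c : ℝ, Tendsto (· + c) l l)
    (hf : ∀ᶠ x in l, f (x + 1) = f x + 1) (k : ℤ) : ∀ᶠ x in l, f (x + k) = f x + k := by
  induction k using Int.induction_on with
  | zero => simp
  | succ n ih =>
    filter_upwards [ih, (hl n).eventually hf] with x h1 h2
    push_cast at h1 ⊢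
    rw [← add_assoc, h2, h1]
    ring
  | pred n ih =>
    filter_upwards [ih, (hl (-n - 1)).eventually hf] with x h1 h2
    push_cast at h1 ⊢
    rw [add_assoc, sub_add_cancel, h1] at h2
    linarith

/-- Near each end `f` commutes with integral translations, so conjugation by `f` does not change the
translation that `n` performs there. -/
theorem conj_mem_Fx {f n : ℝ ≃o ℝ} (hf : f ∈ AutPlusF) (hn : n ∈ Fx) : f * n * f⁻¹ ∈ Fx := by
  obtain ⟨hf, hf1, hf2⟩ := hf
  obtain ⟨hn, ⟨k, hk⟩, ⟨l, hl⟩⟩ := hn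
  refine ⟨mul_mem (mul_mem hf hn) (inv_mem hf), ⟨k, ?_⟩, ⟨l, ?_⟩⟩
  · have h := eventually_add_int (fun c => tendsto_atTop_add_const_right _ c tendsto_id) hf1 k
    filter_upwards [(tendsto_top f⁻¹).eventually hk, (tendsto_top f⁻¹).eventually h] with x h1 h2
    rw [RelIso.mul_apply, RelIso.mul_apply, h1, h2, RelIso.apply_inv_self]
  · have h := eventually_add_int (fun c => tendsto_atBot_add_const_right _ c tendsto_id) hf2 l
    filter_upwards [(tendsto_bot f⁻¹).eventually hl, (tendsto_bot f⁻¹).eventually h] with x h1 h2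
    rw [RelIso.mul_apply, RelIso.mul_apply, h1, h2, RelIso.apply_inv_self]

/-- Two homeomorphisms which induce the same maps to the circle on a half line differ by an integral
translation there. -/
theorem exists_eq_add_int {f g : ℝ ≃o ℝ} {s : Set ℝ} (hs : IsPreconnected s)
    (h : ∀ x ∈ s, (f x : UnitAddCircle) = (g x : UnitAddCircle)) :
    ∃ k : ℤ, ∀ x ∈ s, f x = g x + k := by
  rcases s.eq_empty_or_nonempty with rfl | ⟨a, ha⟩
  · exact ⟨0, by simp⟩
  obtain ⟨k, hk⟩ := circle_eq_iff.1 (h a ha)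
  refine ⟨k, fun x hx => ?_⟩
  have hc : ContinuousOn (fun x => f x - g x) s :=
    (f.continuous.sub g.continuous).continuousOn
  have hmaps : MapsTo (fun x => f x - g x) s (range ((↑) : ℤ → ℝ)) := fun y hy => by
    obtain ⟨m, hm⟩ := circle_eq_iff.1 (h y hy)
    exact ⟨m, by simp only [hm]; ring⟩
  -- A continuous map from a preconnected set into the integers is constant.
  have hT : IsTotallyDisconnected (range ((↑) : ℤ → ℝ)) := by
    apply Set.Countable.isTotallyDisconnected
    exact countable_range _
  have h2 : f x - g x = f a - g a := hT _ (image_subset_iff.2 hmaps) (hs.image _ hc)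
    (mem_image_of_mem _ hx) (mem_image_of_mem _ ha)
  linarith

/-- One periodic extension `lift g` matches `f` modulo integers at both ends, because `C` lies over
the diagonal. Dividing by it leaves an integral translation at each end. -/
theorem exists_mul_lift {f : ℝ ≃o ℝ} (hf : f ∈ C) : ∃ n ∈ Fx, ∃ w ∈ Fw, f = n * w := by
  obtain ⟨⟨hf, -, -⟩, g, hg, h1, h2⟩ := hf
  have hs : ∀ x, lift g ((lift g)⁻¹ x) = x := fun x => RelIso.apply_inv_self _ _
  refine ⟨f * (lift g)⁻¹, ⟨mul_mem hf (inv_mem (lift_mem_PL2 hg)), ?_, ?_⟩, lift g,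
    ⟨g, hg, rfl⟩, by group⟩
  · obtain ⟨K, hK⟩ := eventually_atTop.1 h1
    obtain ⟨k, hk⟩ := exists_eq_add_int (s := Ici K) isPreconnected_Ici hK
    refine ⟨k, ?_⟩
    filter_upwards [(tendsto_top (lift g)⁻¹).eventually (eventually_ge_atTop K)] with x hx
    rw [RelIso.mul_apply, hk _ hx, hs]
  · obtain ⟨K, hK⟩ := eventually_atBot.1 h2
    obtain ⟨k, hk⟩ := exists_eq_add_int (s := Iic K) isPreconnected_Iic hK
    refine ⟨k, ?_⟩
    filter_upwards [(tendsto_bot (lift g)⁻¹).eventually (eventually_le_atBot K)] with x hx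
    rw [RelIso.mul_apply, hk _ hx, hs]

theorem eq_one_of_mem_Fx_of_mem_Fw {f : ℝ ≃o ℝ} (h : f ∈ Fx) (h' : f ∈ Fw) : f = 1 := by
  obtain ⟨g, -, rfl⟩ := h'
  obtain ⟨-, ⟨k, hk⟩, -⟩ := h
  obtain ⟨K, hK⟩ := eventually_atTop.1 hk
  have key : ∀ x, lift g x = x + k := fun x => by
    -- An integral shift brings `x` into the region near `+∞`, and periodicity brings the formula
    -- back.
    have h1 := hK (x + ⌈K - x⌉) (by linarith [Int.le_ceil (K - x)])
    rw [lift_add_int] at h1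
    linarith
  have h0 : lift g 0 = 0 := by
    rw [lift_apply, liftFun, show fractI 0 = ⊥ from Subtype.ext Int.fract_zero, g.map_bot]
    simp
  have hk0 : (k : ℝ) = 0 := by
    rw [key] at h0
    linarith
  ext x
  rw [key, hk0, add_zero]
  rfl

theorem normal_Fx : (Fx.subgroupOf C).Normal :=
  ⟨fun _ hn f => conj_mem_Fx f.2.1 hn⟩

theorem isComplement'_Fx_Fw : Subgroup.IsComplement' (Fx.subgroupOf C) (Fw.subgroupOf C) := by
  apply Subgroup.isComplement'_of_disjoint_and_mul_eq_univ
  · rw [Subgroup.disjoint_def]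
    exact fun h h' => Subtype.ext (eq_one_of_mem_Fx_of_mem_Fw h h')
  · refine eq_univ_of_forall fun f => ?_
    obtain ⟨n, hn, w, hw, e⟩ := exists_mul_lift f.2
    exact ⟨⟨n, Fx_le_C hn⟩, hn, ⟨w, Fw_le_C hw⟩, hw, Subtype.ext e.symm⟩

/-! ### Verification of the eight relations in `C` -/

theorem ThompsonPair.map {G H : Type*} [Group G] [Group H] (φ : G →* H) {a b : G}
    (h : ThompsonPair a b) : ThompsonPair (φ a) (φ b) := by
  obtain ⟨h1, h2⟩ := h
  constructor
  · simpa using h1.map φ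
  · simpa using h2.map φ

theorem ThompsonPair.of_map {G H : Type*} [Group G] [Group H] {φ : G →* H}
    (hφ : Function.Injective φ) {a b : G} (h : ThompsonPair (φ a) (φ b)) : ThompsonPair a b := by
  rw [thompsonPair_iff] at h ⊢
  simpa only [← map_mul, ← map_inv, ← map_zpow, ← map_pow, map_eq_one_iff φ hφ] using h

theorem op_injective {G H : Type*} [Group G] [Group H] {φ : G →* H}
    (hφ : Function.Injective φ) : Function.Injective (MonoidHom.op φ) := fun _ _ h =>
  unop_injective (hφ (op_inj.1 h))

theorem thompsonPair_g0_g1 : ThompsonPair (op g0) (op g1) := by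
  apply ThompsonPair.of_map (op_injective conjTheta_injective)
  change ThompsonPair (op (conjTheta g0)) (op (conjTheta g1))
  rw [conjTheta_g0, conjTheta_g1]
  exact thompsonPair_x0_x1

theorem thompsonPair_w0_w1 : ThompsonPair (op w0) (op w1) :=
  thompsonPair_g0_g1.map (MonoidHom.op lift)

theorem commute_x0_lift (g : I ≃o I) : Commute (op x0) (op (lift g)) := by
  apply unop_injective
  ext t
  exact lift_add_one g t

/-- The condition `h 1 = 1` covers `t = 1`, where the floor jumps, so that the case checks can use
closed intervals. -/
theorem lift_of_mem {g : I ≃o I} {h : ℝ → ℝ} (hg : ∀ t, (g t : ℝ) = h t) (h1 : h 1 = 1) {t : ℝ}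
    (ht : 0 ≤ t) (ht' : t ≤ 1) : lift g t = h t := by
  rcases ht'.eq_or_lt with rfl | ht'
  · have e := lift_add_one g 0
    have e0 : lift g 0 = 0 := by
      rw [lift_apply, liftFun, show fractI 0 = ⊥ from Subtype.ext Int.fract_zero, g.map_bot]
      simp
    rw [zero_add] at e
    rw [e, e0, h1, zero_add]
  · have e1 : ⌊t⌋ = 0 := Int.floor_eq_zero_iff.2 ⟨ht, ht'⟩
    have e2 : ((fractI t : I) : ℝ) = t := Int.fract_eq_self.2 ⟨ht, ht'⟩
    rw [lift_apply, liftFun, e1, hg, e2]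
    simp

theorem lift_of_mem_Icc_one_two {g : I ≃o I} {h : ℝ → ℝ} (hg : ∀ t, (g t : ℝ) = h t) (h1 : h 1 = 1)
    {t : ℝ} (ht : 1 ≤ t) (ht' : t ≤ 2) : lift g t = h (t - 1) + 1 := by
  rw [← lift_of_mem hg h1 (by linarith) (by linarith), ← lift_add_one, sub_add_cancel]

theorem lift_nonpos (g : I ≃o I) {t : ℝ} (ht : t ≤ 0) : lift g t ≤ 0 := by
  have h := (lift g).monotone ht
  rwa [lift_apply g 0, liftFun, show fractI 0 = ⊥ from Subtype.ext Int.fract_zero, g.map_bot,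
    Int.floor_zero, show ((⊥ : I) : ℝ) = 0 from rfl, Int.cast_zero, add_zero] at h

theorem one_le_lift (g : I ≃o I) {t : ℝ} (ht : 1 ≤ t) : 1 ≤ lift g t := by
  by_contra h
  have h1 := (lift g)⁻¹.strictMono (not_le.1 h)
  rw [RelIso.inv_apply_self, ← map_inv] at h1
  have h2 := lift_nonpos g⁻¹ (t := 0) le_rfl
  have h3 := lift_add_one g⁻¹ 0
  rw [zero_add] at h3
  linarith

theorem w0_of_mem {t : ℝ} (ht : 0 ≤ t) (ht' : t ≤ 1) : w0 t = g0Fun t :=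
  lift_of_mem (fun _ => rfl) (by norm_num [g0Fun]) ht ht'

theorem w0_of_mem_Icc_one_two {t : ℝ} (ht : 1 ≤ t) (ht' : t ≤ 2) : w0 t = g0Fun (t - 1) + 1 :=
  lift_of_mem_Icc_one_two (fun _ => rfl) (by norm_num [g0Fun]) ht ht'

theorem w1_of_mem {t : ℝ} (ht : 0 ≤ t) (ht' : t ≤ 1) : w1 t = g1Fun t :=
  lift_of_mem (fun _ => rfl) (by norm_num [g1Fun]) ht ht'

theorem w1_of_mem_Icc_one_two {t : ℝ} (ht : 1 ≤ t) (ht' : t ≤ 2) : w1 t = g1Fun (t - 1) + 1 :=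
  lift_of_mem_Icc_one_two (fun _ => rfl) (by norm_num [g1Fun]) ht ht'

theorem g0Fun_of_le {t : ℝ} (h : t ≤ 1 / 4) : g0Fun t = 2 * t := if_pos h

theorem g0Fun_of_mem {t : ℝ} (h : 1 / 4 ≤ t) (h' : t ≤ 1 / 2) : g0Fun t = t + 1 / 4 := by
  unfold g0Fun
  split_ifs <;> linarith

theorem g0Fun_of_ge {t : ℝ} (h : 1 / 2 ≤ t) : g0Fun t = (t + 1) / 2 := by
  unfold g0Fun
  split_ifs <;> linarith

theorem g1Fun_of_le {t : ℝ} (h : t ≤ 1 / 2) : g1Fun t = t := if_pos h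

theorem g1Fun_of_mem {t : ℝ} (h : 1 / 2 ≤ t) (h' : t ≤ 5 / 8) : g1Fun t = 2 * t - 1 / 2 := by
  unfold g1Fun
  split_ifs <;> linarith

theorem g1Fun_of_mem' {t : ℝ} (h : 5 / 8 ≤ t) (h' : t ≤ 3 / 4) : g1Fun t = t + 1 / 8 := by
  unfold g1Fun
  split_ifs <;> linarith

theorem g1Fun_of_ge {t : ℝ} (h : 3 / 4 ≤ t) : g1Fun t = (t + 1) / 2 := by
  unfold g1Fun
  split_ifs <;> linarith

/-- The right hand side of the relation for the conjugate of `x1` by `w0`. -/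
def conjWord0 {G : Type*} [Group G] (a b : G) : G :=
  b ^ 3 * a⁻¹ * b * a ^ (-3 : ℤ) * b * a * b ^ (-2 : ℤ) * a ^ 3 * b ^ (-2 : ℤ)

/-- The right hand side of the relation for the conjugate of `x1` by `w1`. -/
def conjWord1 {G : Type*} [Group G] (a b : G) : G :=
  b ^ 2 * a⁻¹ * b * a⁻¹ * b * a ^ (-2 : ℤ) * b ^ 2 * a ^ (-2 : ℤ) * b * a *
    b ^ (-2 : ℤ) * a * b⁻¹ * a ^ 3 * b ^ (-2 : ℤ) * a * b⁻¹

theorem unop_conjWord0_apply (t : ℝ) : unop (conjWord0 (op x0) (op x1)) t =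
    x1⁻¹ (x1⁻¹ (x0 (x0 (x0 (x1⁻¹ (x1⁻¹ (x0 (x1 (x0⁻¹ (x0⁻¹ (x0⁻¹ (x1 (x0⁻¹ (x1 (x1 (x1
      t)))))))))))))))) := by
  have h : ∀ {G : Type} [Group G] (a b : G), conjWord0 a b =
      b * b * b * a⁻¹ * b * a⁻¹ * a⁻¹ * a⁻¹ * b * a * b⁻¹ * b⁻¹ * a * a * a * b⁻¹ * b⁻¹ := by
    intro G _ a b
    simp only [conjWord0, zpow_neg, zpow_ofNat, pow_succ, pow_zero, one_mul, mul_inv_rev,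
      mul_assoc]
  rw [h]
  simp only [unop_mul, unop_inv, MulOpposite.unop_op, RelIso.mul_apply]

theorem unop_conjWord1_apply (t : ℝ) : unop (conjWord1 (op x0) (op x1)) t =
    x1⁻¹ (x0 (x1⁻¹ (x1⁻¹ (x0 (x0 (x0 (x1⁻¹ (x0 (x1⁻¹ (x1⁻¹ (x0 (x1 (x0⁻¹ (x0⁻¹ (x1 (x1
      (x0⁻¹ (x0⁻¹ (x1 (x0⁻¹ (x1 (x0⁻¹ (x1 (x1 t)))))))))))))))))))))))) := by
  have h : ∀ {G : Type} [Group G] (a b : G), conjWord1 a b =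
      b * b * a⁻¹ * b * a⁻¹ * b * a⁻¹ * a⁻¹ * b * b * a⁻¹ * a⁻¹ * b * a * b⁻¹ * b⁻¹ * a *
        b⁻¹ * a * a * a * b⁻¹ * b⁻¹ * a * b⁻¹ := by
    intro G _ a b
    simp only [conjWord1, zpow_neg, zpow_ofNat, pow_succ, pow_zero, one_mul, mul_inv_rev,
      mul_assoc]
  rw [h]
  simp only [unop_mul, unop_inv, MulOpposite.unop_op, RelIso.mul_apply]

/-- Both sides are the identity on `(-∞, 0]`, where only the `x0` letters act and their exponents
cancel, and translation by `1` on `[1, ∞)`. Between these the identity is checked on each affine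
piece. -/
theorem w0_conj_x1 : op w0 * op x1 * (op w0)⁻¹ = conjWord0 (op x0) (op x1) := by
  rw [mul_inv_eq_iff_eq_mul]
  apply unop_injective
  ext t
  change x1 (w0 t) = w0 (unop (conjWord0 (op x0) (op x1)) t)
  rw [unop_conjWord0_apply]
  rcases le_total t 0 with h0 | h0
  · have h1 : w0 t ≤ 0 := lift_nonpos g0 h0
    rw [x1_of_le_zero h1]
    simp (disch := refine le_of_not_gt fun h => ?_; linarith) only [x0_apply, x0_inv_apply,
      x1_of_le_zero,
      x1_inv_of_le_zero]
    congr 1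
    linarith
  rcases le_total 1 t with h1 | h1
  · have h2 : 1 ≤ w0 t := one_le_lift g0 h1
    rw [x1_of_one_le h2, w0, ← lift_add_one]
    simp (disch := refine le_of_not_gt fun h => ?_; linarith) only [x0_apply, x0_inv_apply,
      x1_of_one_le, x1_inv_of_two_le]
    congr 1
    linarith
  -- The cuts are fine enough that on each piece every intermediate value stays within one affine
  -- piece of the next map.
  have cover : t ≤ 1 / 8 ∨ (1 / 8 ≤ t ∧ t ≤ 3 / 16) ∨ (3 / 16 ≤ t ∧ t ≤ 1 / 4) ∨ (1 / 4 ≤ t ∧ t ≤ 1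
      / 2) ∨ (1 / 2 ≤ t ∧ t ≤ 3 / 4) ∨ 3 / 4 ≤ t := by
    grind
  rcases cover with h2 | ⟨h2, h3⟩ | ⟨h2, h3⟩ | ⟨h2, h3⟩ | ⟨h2, h3⟩ | h2 <;>
    (simp (disch := refine le_of_not_gt fun h => ?_; linarith) only [x0_apply, x0_inv_apply,
      x1_of_le_zero, x1_inv_of_le_zero,
        x1_of_mem, x1_inv_of_mem, x1_of_one_le, x1_inv_of_two_le, w0_of_mem, w0_of_mem_Icc_one_two,
        g0Fun_of_le, g0Fun_of_mem, g0Fun_of_ge]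
     linarith)

set_option maxHeartbeats 1000000 in
theorem w1_conj_x1 : op w1 * op x1 * (op w1)⁻¹ = conjWord1 (op x0) (op x1) := by
  rw [mul_inv_eq_iff_eq_mul]
  apply unop_injective
  ext t
  change x1 (w1 t) = w1 (unop (conjWord1 (op x0) (op x1)) t)
  rw [unop_conjWord1_apply]
  rcases le_total t 0 with h0 | h0
  · have h1 : w1 t ≤ 0 := lift_nonpos g1 h0
    rw [x1_of_le_zero h1]
    simp (disch := refine le_of_not_gt fun h => ?_; linarith) only [x0_apply, x0_inv_apply,
      x1_of_le_zero,
      x1_inv_of_le_zero]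
    congr 1
    linarith
  rcases le_total 1 t with h1 | h1
  · have h2 : 1 ≤ w1 t := one_le_lift g1 h1
    rw [x1_of_one_le h2, w1, ← lift_add_one]
    simp (disch := refine le_of_not_gt fun h => ?_; linarith) only [x0_apply, x0_inv_apply,
      x1_of_one_le, x1_inv_of_two_le]
    congr 1
    linarith
  have cover : t ≤ 1 / 4 ∨ (1 / 4 ≤ t ∧ t ≤ 3 / 8) ∨ (3 / 8 ≤ t ∧ t ≤ 7 / 16) ∨ (7 / 16 ≤ t ∧ t ≤ 1
      / 2) ∨ (1 / 2 ≤ t ∧ t ≤ 5 / 8) ∨ (5 / 8 ≤ t ∧ t ≤ 3 / 4) ∨ (3 / 4 ≤ t ∧ t ≤ 7 / 8) ∨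
      7 / 8 ≤ t := by
    grind
  rcases cover with h2 | ⟨h2, h3⟩ | ⟨h2, h3⟩ | ⟨h2, h3⟩ | ⟨h2, h3⟩ | ⟨h2, h3⟩ | ⟨h2, h3⟩ | h2 <;>
    (simp (disch := refine le_of_not_gt fun h => ?_; linarith) only [x0_apply, x0_inv_apply,
      x1_of_le_zero, x1_inv_of_le_zero,
        x1_of_mem, x1_inv_of_mem, x1_of_one_le, x1_inv_of_two_le, w1_of_mem, w1_of_mem_Icc_one_two,
        g1Fun_of_le, g1Fun_of_mem, g1Fun_of_mem',
        g1Fun_of_ge]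
     linarith)

/-! ### Faithfulness on subgroups generated by a Thompson pair -/

theorem map_lift_cond {G H : Type*} [Group G] [Group H] (φ : G →* H) (a b : G)
    (u : FreeGroup Bool) : φ (FreeGroup.lift (fun i => cond i a b) u) =
      FreeGroup.lift (fun i => cond i (φ a) (φ b)) u := by
  have : φ.comp (FreeGroup.lift fun i => cond i a b) =
      FreeGroup.lift fun i => cond i (φ a) (φ b) := by
    ext i
    cases i <;> simp
  exact DFunLike.congr_fun this u

theorem exists_lift_cond_eq {G : Type*} [Group G] {a b g : G}
    (hg : g ∈ Subgroup.closure {a, b}) :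
    ∃ u, FreeGroup.lift (fun i => cond i a b) u = g := by
  have h : Subgroup.closure {a, b} ≤ (FreeGroup.lift fun i => cond i a b).range := by
    rw [Subgroup.closure_le]
    rintro _ (rfl | rfl)
    · exact ⟨.of true, by simp⟩
    · exact ⟨.of false, by simp⟩
  exact h hg

theorem ThompsonPair.eq_one_of_map_x0_x1 {G : Type*} [Group G] {a b : G} (h : ThompsonPair a b)
    {φ : G →* (ℝ ≃o ℝ)ᵐᵒᵖ} (ha : φ a = op x0) (hb : φ b = op x1) {g : G}
    (hg : g ∈ Subgroup.closure {a, b}) (e : φ g = 1) : g = 1 := by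
  obtain ⟨u, rfl⟩ := exists_lift_cond_eq hg
  rw [map_lift_cond, ha, hb] at e
  exact h.lift_eq_one u e

/-- A word trivial on `w0, w1` is trivial on `g0, g1` since `lift` is injective, hence on their
conjugates `x0, x1` under `theta`. -/
theorem ThompsonPair.eq_one_of_map_w0_w1 {G : Type*} [Group G] {a b : G} (h : ThompsonPair a b)
    {φ : G →* (ℝ ≃o ℝ)ᵐᵒᵖ} (ha : φ a = op w0) (hb : φ b = op w1) {g : G}
    (hg : g ∈ Subgroup.closure {a, b}) (e : φ g = 1) : g = 1 := by
  obtain ⟨u, rfl⟩ := exists_lift_cond_eq hg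
  rw [map_lift_cond, ha, hb] at e
  apply h.lift_eq_one u
  have e1 : FreeGroup.lift (fun i => cond i (op g0) (op g1)) u = 1 := by
    apply op_injective lift_injective
    rw [map_lift_cond, map_one]
    exact e
  have e2 := congrArg (MonoidHom.op conjTheta) e1
  rw [map_lift_cond, map_one] at e2
  change FreeGroup.lift (fun i => cond i (op (conjTheta g0)) (op (conjTheta g1))) u = 1 at e2
  rwa [conjTheta_g0, conjTheta_g1] at e2

theorem closure_op_pair {G : Type*} [Group G] (a b : G) :
    Subgroup.closure {op a, op b} = (Subgroup.closure {a, b}).op := by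
  rw [Subgroup.op_closure]
  congr 1
  ext x
  simp [← unop_inj]

/-! ### The abstract group with eight relators and its isomorphism with `C` -/

theorem relator_eq_one {r : FreeGroup Gen} (hr : r ∈ relatorsC) :
    FreeGroup.lift (fun s : Gen => op s.toHomeo) r = 1 := by
  obtain ⟨h1, h2⟩ := thompsonPair_iff.1 thompsonPair_x0_x1
  obtain ⟨h3, h4⟩ := thompsonPair_iff.1 thompsonPair_w0_w1
  rcases hr with ((rfl | rfl) | (rfl | rfl)) | (rfl | rfl | rfl | rfl) <;>
    simp only [comm, map_mul, map_inv, map_pow, map_zpow, FreeGroup.lift_apply_of, Gen.toHomeo]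
  · exact h1
  · exact h2
  · exact h3
  · exact h4
  · rw [mul_inv_eq_one, mul_inv_eq_iff_eq_mul]
    exact commute_x0_lift g0
  · rw [mul_inv_eq_one, mul_inv_eq_iff_eq_mul]
    exact commute_x0_lift g1
  · rw [mul_inv_eq_one]
    exact w0_conj_x1
  · rw [mul_inv_eq_one]
    exact w1_conj_x1

theorem toHomeo_mem_C (s : Gen) : s.toHomeo ∈ C := by
  cases s
  · exact Fx_le_C x0_mem_Fx
  · exact Fx_le_C x1_mem_Fx
  · exact Fw_le_C ⟨g0, g0_mem_F, rfl⟩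
  · exact Fw_le_C ⟨g1, g1_mem_F, rfl⟩

theorem lift_toHomeo_C (r : FreeGroup Gen) :
    MonoidHom.op C.subtype (FreeGroup.lift (fun s => op ⟨s.toHomeo, toHomeo_mem_C s⟩) r) =
      FreeGroup.lift (fun s : Gen => op s.toHomeo) r := by
  have : (MonoidHom.op C.subtype).comp
      (FreeGroup.lift (fun s => op ⟨s.toHomeo, toHomeo_mem_C s⟩)) =
      FreeGroup.lift (fun s : Gen => op s.toHomeo) := by
    ext s
    simp
  exact DFunLike.congr_fun this r

/-- The homomorphism from the abstract group with the eight relators to `C`. -/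
noncomputable def presentedToC : PresentedGroup relatorsC →* Cᵐᵒᵖ :=
  PresentedGroup.toGroup (f := fun s => op ⟨s.toHomeo, toHomeo_mem_C s⟩) fun r hr => by
    apply op_injective C.subtype_injective
    rw [lift_toHomeo_C, map_one, relator_eq_one hr]

/-- The homomorphism from the abstract group with the eight relators to the homeomorphisms of the
line. -/
noncomputable def presentedToHomeo : PresentedGroup relatorsC →* (ℝ ≃o ℝ)ᵐᵒᵖ :=
  (MonoidHom.op C.subtype).comp presentedToC

theorem unop_presentedToHomeo_mem (g : PresentedGroup relatorsC) :
    unop (presentedToHomeo g) ∈ C := (unop (presentedToC g)).2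

theorem presentedToC_of (s : Gen) :
    presentedToC (PresentedGroup.of s) = op ⟨s.toHomeo, toHomeo_mem_C s⟩ :=
  PresentedGroup.toGroup.of _

theorem presentedToHomeo_of (s : Gen) :
    presentedToHomeo (PresentedGroup.of s) = op s.toHomeo := by
  rw [presentedToHomeo, MonoidHom.comp_apply, presentedToC_of]
  rfl

/-- The subgroup generated by the symbols of `x₀` and `x₁`. -/
def presentedX : Subgroup (PresentedGroup relatorsC) :=
  Subgroup.closure {PresentedGroup.of .x0, PresentedGroup.of .x1}

/-- The subgroup generated by the symbols of `w₀` and `w₁`. -/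
def presentedW : Subgroup (PresentedGroup relatorsC) :=
  Subgroup.closure {PresentedGroup.of .w0, PresentedGroup.of .w1}

theorem thompsonPair_of_relatorsF {a b : Gen} (h : relatorsF (.of a) (.of b) ⊆ relatorsC) :
    ThompsonPair (PresentedGroup.of a : PresentedGroup relatorsC) (PresentedGroup.of b) :=
  thompsonPair_iff.2 ⟨PresentedGroup.one_of_mem (h (Or.inl rfl)),
    PresentedGroup.one_of_mem (h (Or.inr rfl))⟩

theorem eq_one_of_mem_presentedX {g : PresentedGroup relatorsC} (hg : g ∈ presentedX)
    (e : presentedToHomeo g = 1) : g = 1 :=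
  (thompsonPair_of_relatorsF (subset_union_left.trans subset_union_left)).eq_one_of_map_x0_x1
    (presentedToHomeo_of .x0) (presentedToHomeo_of .x1) hg e

theorem eq_one_of_mem_presentedW {g : PresentedGroup relatorsC} (hg : g ∈ presentedW)
    (e : presentedToHomeo g = 1) : g = 1 :=
  (thompsonPair_of_relatorsF (subset_union_right.trans subset_union_left)).eq_one_of_map_w0_w1
    (presentedToHomeo_of .w0) (presentedToHomeo_of .w1) hg e

theorem map_presentedX : presentedX.map presentedToHomeo = Fx.op := by
  rw [presentedX, MonoidHom.map_closure, image_pair, presentedToHomeo_of, presentedToHomeo_of,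
    ← closure_x0_x1]
  exact closure_op_pair _ _

theorem map_presentedW : presentedW.map presentedToHomeo = Fw.op := by
  rw [presentedW, MonoidHom.map_closure, image_pair, presentedToHomeo_of, presentedToHomeo_of,
    ← closure_w0_w1]
  exact closure_op_pair _ _

/-- An element which conjugates both generators of `presentedX` into `presentedX` normalizes it. -/
theorem mem_normalizer_presentedX {w : PresentedGroup relatorsC}
    (h0 : w * PresentedGroup.of .x0 * w⁻¹ ∈ presentedX)
    (h1 : w * PresentedGroup.of .x1 * w⁻¹ ∈ presentedX) :
    w ∈ Subgroup.normalizer (presentedX : Set (PresentedGroup relatorsC)) := by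
  have hle : ∀ n ∈ presentedX, w * n * w⁻¹ ∈ presentedX := by
    have : presentedX ≤ presentedX.comap (MulAut.conj w).toMonoidHom := by
      conv_lhs => rw [presentedX]
      rw [Subgroup.closure_le]
      rintro _ (rfl | rfl)
      · exact h0
      · exact h1
    exact this
  rw [Subgroup.mem_normalizer_iff]
  refine fun n => ⟨hle n, fun hn => ?_⟩
  -- The converse inclusion concerns conjugation by `w⁻¹`, of which the hypotheses say nothing. The
  -- image of `n` lies in `Fx` by normality on the side of homeomorphisms.
  have hFx : presentedToHomeo n ∈ Fx.op := by
    have h2 : presentedToHomeo (w * n * w⁻¹) ∈ Fx.op :=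
      map_presentedX ▸ Subgroup.mem_map_of_mem _ hn
    have h3 := conj_mem_Fx (unop_presentedToHomeo_mem w).1 (Subgroup.mem_op.1 h2)
    simp only [map_mul, map_inv, unop_mul, unop_inv] at h3
    rw [Subgroup.mem_op]
    convert h3 using 1
    group
  rw [← map_presentedX] at hFx
  obtain ⟨n', hn', e⟩ := hFx
  -- `n'` is an element of `presentedX` with the same image as `n`. Both conjugates lie in
  -- `presentedX`, where the map is faithful, so they agree and `n = n'`.
  have h4 : w * n' * w⁻¹ * (w * n * w⁻¹)⁻¹ = 1 := by
    apply eq_one_of_mem_presentedX (mul_mem (hle n' hn') (inv_mem hn))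
    simp only [map_mul, map_inv, e, mul_inv_cancel]
  rw [mul_inv_eq_one, mul_left_inj, mul_right_inj] at h4
  rwa [← h4]

theorem conjWord_mem_presentedX :
    conjWord0 (PresentedGroup.of .x0) (PresentedGroup.of .x1) ∈ presentedX ∧
    conjWord1 (PresentedGroup.of .x0) (PresentedGroup.of .x1) ∈ presentedX := by
  have h0 : PresentedGroup.of .x0 ∈ presentedX := Subgroup.subset_closure (Or.inl rfl)
  have h1 : PresentedGroup.of .x1 ∈ presentedX := Subgroup.subset_closure (Or.inr rfl)
  constructor
  · unfold conjWord0
    repeat' apply_rules [mul_mem, pow_mem, zpow_mem, inv_mem]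
  · unfold conjWord1
    repeat' apply_rules [mul_mem, pow_mem, zpow_mem, inv_mem]

theorem closure_generators :
    Subgroup.closure (range (PresentedGroup.of : Gen → PresentedGroup relatorsC)) = ⊤ :=
  PresentedGroup.closure_range_of _

/-- The normalizer is a subgroup, so it is enough that it contains the four generators; for `w₀` and
`w₁` this is what the last four relators provide. -/
theorem normal_presentedX : presentedX.Normal := by
  rw [← Subgroup.normalizer_eq_top_iff, eq_top_iff, ← closure_generators, Subgroup.closure_le]
  have hx : ∀ s, (s = .x0 ∨ s = .x1) → PresentedGroup.of s ∈ presentedX := by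
    rintro s (rfl | rfl)
    · exact Subgroup.subset_closure (Or.inl rfl)
    · exact Subgroup.subset_closure (Or.inr rfl)
  have hcomm : ∀ s, comm (.of .x0) (.of s) ∈ relatorsC →
      (PresentedGroup.of s : PresentedGroup relatorsC) * PresentedGroup.of .x0 *
        (PresentedGroup.of s)⁻¹ ∈ presentedX := by
    intro s hs
    have h1 : (PresentedGroup.of .x0 : PresentedGroup relatorsC) * PresentedGroup.of s *
        (PresentedGroup.of .x0)⁻¹ * (PresentedGroup.of s)⁻¹ = 1 := PresentedGroup.one_of_mem hs
    rw [mul_inv_eq_one, mul_inv_eq_iff_eq_mul] at h1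
    rw [← h1, mul_inv_cancel_right]
    exact hx _ (Or.inl rfl)
  rintro _ ⟨s, rfl⟩
  cases s with
  | x0 => exact Subgroup.le_normalizer (hx _ (Or.inl rfl))
  | x1 => exact Subgroup.le_normalizer (hx _ (Or.inr rfl))
  | w0 =>
    refine mem_normalizer_presentedX (hcomm _ (Or.inr (Or.inl rfl))) ?_
    have h : (PresentedGroup.of .w0 : PresentedGroup relatorsC) * PresentedGroup.of .x1 *
        (PresentedGroup.of .w0)⁻¹ *
        (conjWord0 (PresentedGroup.of .x0) (PresentedGroup.of .x1))⁻¹ = 1 :=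
      PresentedGroup.one_of_mem (Or.inr (Or.inr (Or.inr (Or.inl rfl))))
    rw [mul_inv_eq_one.1 h]
    exact conjWord_mem_presentedX.1
  | w1 =>
    refine mem_normalizer_presentedX (hcomm _ (Or.inr (Or.inr (Or.inl rfl)))) ?_
    have h : (PresentedGroup.of .w1 : PresentedGroup relatorsC) * PresentedGroup.of .x1 *
        (PresentedGroup.of .w1)⁻¹ *
        (conjWord1 (PresentedGroup.of .x0) (PresentedGroup.of .x1))⁻¹ = 1 :=
      PresentedGroup.one_of_mem (Or.inr (Or.inr (Or.inr (Or.inr rfl))))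
    rw [mul_inv_eq_one.1 h]
    exact conjWord_mem_presentedX.2

theorem exists_mul_eq (g : PresentedGroup relatorsC) :
    ∃ n ∈ presentedX, ∃ w ∈ presentedW, n * w = g := by
  have := normal_presentedX
  have htop : presentedX ⊔ presentedW = ⊤ := by
    rw [eq_top_iff, ← closure_generators, Subgroup.closure_le]
    rintro _ ⟨s, rfl⟩
    cases s
    · exact Subgroup.mem_sup_left (Subgroup.subset_closure (Or.inl rfl))
    · exact Subgroup.mem_sup_left (Subgroup.subset_closure (Or.inr rfl))
    · exact Subgroup.mem_sup_right (Subgroup.subset_closure (Or.inl rfl))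
    · exact Subgroup.mem_sup_right (Subgroup.subset_closure (Or.inr rfl))
  have hg : g ∈ ((presentedX ⊔ presentedW : Subgroup _) : Set (PresentedGroup relatorsC)) := by
    rw [htop]
    trivial
  rw [Subgroup.normal_mul] at hg
  exact hg

theorem presentedToC_bijective : Function.Bijective presentedToC := by
  constructor
  · rw [injective_iff_map_eq_one]
    intro g hg
    obtain ⟨n, hn, w, hw, rfl⟩ := exists_mul_eq g
    have e : presentedToHomeo n * presentedToHomeo w = 1 := by
      rw [← map_mul, presentedToHomeo, MonoidHom.comp_apply, hg, map_one]
    have hnx : presentedToHomeo n ∈ Fx.op := map_presentedX ▸ Subgroup.mem_map_of_mem _ hn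
    have hww : presentedToHomeo w ∈ Fw.op := map_presentedW ▸ Subgroup.mem_map_of_mem _ hw
    have hnw : presentedToHomeo n ∈ Fw.op := by
      rw [eq_inv_of_mul_eq_one_left e]
      exact inv_mem hww
    have hn1 : presentedToHomeo n = 1 := unop_injective (eq_one_of_mem_Fx_of_mem_Fw hnx hnw)
    rw [hn1, one_mul] at e
    rw [eq_one_of_mem_presentedX hn hn1, eq_one_of_mem_presentedW hw e, one_mul]
  · intro f
    obtain ⟨n, hn, w, hw, e⟩ := exists_mul_lift (unop f).2
    have hn' : op n ∈ presentedX.map presentedToHomeo := by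
      rw [map_presentedX]
      exact hn
    have hw' : op w ∈ presentedW.map presentedToHomeo := by
      rw [map_presentedW]
      exact hw
    obtain ⟨a, -, ha⟩ := hn'
    obtain ⟨b, -, hb⟩ := hw'
    -- The factors are reversed because the target is the opposite group: `op w * op n = op (n *
    -- w)`.
    refine ⟨b * a, op_injective C.subtype_injective ?_⟩
    change presentedToHomeo (b * a) = op ((unop f : C) : ℝ ≃o ℝ)
    rw [map_mul, ha, hb, e, op_mul]

end ThompsonAut

/-- The group `C` is the internal semidirect product of its normal subgroup `F_x` and its subgroup
`F_w`, and it is presented by the four generators and the eight relators. Words in the generators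
are read as compositions of maps from left to right, hence the opposite group. -/
theorem mainTheorem4 :
    ThompsonAut.Fx ≤ ThompsonAut.C ∧ ThompsonAut.Fw ≤ ThompsonAut.C ∧
    (ThompsonAut.Fx.subgroupOf ThompsonAut.C).Normal ∧
    Subgroup.IsComplement' (ThompsonAut.Fx.subgroupOf ThompsonAut.C)
      (ThompsonAut.Fw.subgroupOf ThompsonAut.C) ∧
    ∃ e : PresentedGroup ThompsonAut.relatorsC ≃* (ThompsonAut.C)ᵐᵒᵖ,
      ∀ s : ThompsonAut.Gen,
        ((MulOpposite.unop (e (PresentedGroup.of s)) : ThompsonAut.C) : ℝ ≃o ℝ) = s.toHomeo :=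
  ⟨ThompsonAut.Fx_le_C, ThompsonAut.Fw_le_C, ThompsonAut.normal_Fx,
    ThompsonAut.isComplement'_Fx_Fw,
    MulEquiv.ofBijective ThompsonAut.presentedToC ThompsonAut.presentedToC_bijective, fun s => by
      rw [MulEquiv.ofBijective_apply, ThompsonAut.presentedToC_of]
      rfl⟩
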